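/- Let $\mathbb K=\mathbb C$ (resp. $\mathbb K=\mathbb R$) and let $f$ be holomorphic (resp. real analytic) near $0\in\mathbb K^2$, with $f(0,0)=0$ and $f\not\equiv 0$ near $0$. Set $c_0(f)=\sup\{c>0:\ \int_{B_\epsilon(0)}|f|^{-c}<\infty\text{ for some }\epsilon>0\}$. If $f(x,y)=\sum a_{p,q}x^py^q$ is the Taylor series of $f$ at $0$, let $NP(f)\subset\mathbb R^2$ be the convex hull of $\bigcup_{a_{p,q}\neq 0}\big((p,q)+\mathbb R_{\ge 0}^2\big)$, and define the Newton distance $\delta_{NP}>0$ by $\delta_{NP}^{-1}=\inf\{t\ge 0:(t,t)\in NP(f)\}$. Then $f$ has a Puiseux factorization $$f(x,y)=(\text{unit})\cdot x^\alpha y^\beta\prod_{\nu=1}^N\big(y-\phi_\nu(x)\big),\qquad \phi_\nu(x)=\psi_\nu(x^{1/n}),$$ with integers $\alpha,\beta,N\ge 0$ and $n\ge 1$ and convergent complex power series $\psi_\nu\not\equiv 0$ with $\psi_\nu(0)=0$; precisely, $f(t^n,y)=u(t,y)\,t^{n\alpha}y^\beta\prod_\nu(y-\psi_\nu(t))$ for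 $(t,y)\in\mathbb K^2$ near $0$, with $u$ holomorphic near $0\in\mathbb C^2$ and $u(0,0)\ne 0$. For any such factorization, and for $a\in\mathbb Q_{>0}$, $b\in\mathbb C\setminus\{0\}$, let $m_{a,b}$ be the number of indices $\nu$ for which $\phi_\nu$ has leading term $b\,x^a$, i.e. $\psi_\nu(t)=b\,t^{na}+O(t^{na+1})$ with $na\in\mathbb N$. If $m_{a,b}\le\delta_{NP}^{-1}$ for all $a,b$, then $c_0(f)=2\,\delta_{NP}$ if $\mathbb K=\mathbb C$ (resp. $c_0(f)=\delta_{NP}$ if $\mathbb K=\mathbb R$). -/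

import Mathlib

open Filter Topology MeasureTheory Asymptotics

noncomputable section

namespace NewtonPuiseux

/-- The Euclidean ball of radius `ε` about the origin of `𝕜²` (here `𝕜` is `ℝ` or `ℂ`). -/
def euclBall (𝕜 : Type*) [NormedField 𝕜] (ε : ℝ) : Set (𝕜 × 𝕜) :=
  {z | ‖z.1‖ ^ 2 + ‖z.2‖ ^ 2 < ε ^ 2}

/-- The critical integrability index of `f` at the origin, the supremum of all `c > 0` such that
`|f| ^ (-c)` has finite integral over some ball about the origin. The integrand takes the value
`∞` on the zero set of `f`, and the supremum is taken in `[0, ∞]`. -/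
def criticalIndex {𝕜 : Type*} [NormedField 𝕜] [MeasureSpace 𝕜] (f : 𝕜 × 𝕜 → 𝕜) : ENNReal :=
  sSup (ENNReal.ofReal ''
    {c : ℝ | 0 < c ∧ ∃ ε : ℝ, 0 < ε ∧ ∫⁻ z in euclBall 𝕜 ε, ‖f z‖ₑ ^ (-c) < ⊤})

/-- The coefficient of `x ^ p * y ^ q` in the Taylor series of `f` at the origin. -/
def taylorCoeff {𝕜 : Type*} [NontriviallyNormedField 𝕜] (f : 𝕜 × 𝕜 → 𝕜) (p q : ℕ) : 𝕜 :=
  iteratedDeriv p (fun x => iteratedDeriv q (fun y => f (x, y)) 0) 0 /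
    ((p.factorial : 𝕜) * (q.factorial : 𝕜))

/-- The Newton polyhedron, the convex hull of the union of the orthants `(p, q) + ℝ²_{≥ 0}` over
the monomials `x ^ p * y ^ q` that appear in the Taylor series of `f`. -/
def newtonPolyhedron {𝕜 : Type*} [NontriviallyNormedField 𝕜] (f : 𝕜 × 𝕜 → 𝕜) : Set (ℝ × ℝ) :=
  convexHull ℝ {w | ∃ p q : ℕ, taylorCoeff f p q ≠ 0 ∧ (p : ℝ) ≤ w.1 ∧ (q : ℝ) ≤ w.2}

/-- The Newton distance `δ`, given by `δ⁻¹ = inf {t ≥ 0 : (t, t) ∈ NP(f)}`. -/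
def newtonDist {𝕜 : Type*} [NontriviallyNormedField 𝕜] (f : 𝕜 × 𝕜 → 𝕜) : ℝ :=
  (sInf {t : ℝ | 0 ≤ t ∧ (t, t) ∈ newtonPolyhedron f})⁻¹

/-- The data of a factorization `unit * x ^ α * y ^ β * ∏ ν, (y - φ_ν(x))` into convergent Puiseux
series `φ_ν(x) = ψ_ν(x ^ (1 / n))`, with `φ_ν` not identically zero and `φ_ν(0) = 0`, written in
the variables `(t, y)` where `x = t ^ n`. -/
structure PuiseuxData where
  /-- the exponent of `x` -/
  α : ℕ
  /-- the exponent of `y` -/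
  β : ℕ
  /-- the number of nonzero roots, with multiplicity -/
  N : ℕ
  /-- the common denominator of the exponents of the roots -/
  n : ℕ
  n_pos : 0 < n
  /-- the roots, as functions of `t = x ^ (1 / n)` -/
  ψ : Fin N → ℂ → ℂ
  ψ_analytic : ∀ ν, AnalyticAt ℂ (ψ ν) 0
  ψ_zero : ∀ ν, ψ ν 0 = 0
  ψ_ne_zero : ∀ ν, ¬ ∀ᶠ t in 𝓝 (0 : ℂ), ψ ν t = 0
  /-- the unit -/
  u : ℂ × ℂ → ℂ
  u_analytic : AnalyticAt ℂ u 0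
  u_ne_zero : u 0 ≠ 0

namespace PuiseuxData

/-- The value of the factorized expression at `(x, y) = (t ^ n, y)`. -/
def eval (D : PuiseuxData) (t y : ℂ) : ℂ :=
  D.u (t, y) * ((t ^ D.n) ^ D.α * y ^ D.β * ∏ ν, (y - D.ψ ν t))

/-- `D` is a Puiseux factorization of the holomorphic germ `f`. -/
def FactorsComplex (D : PuiseuxData) (f : ℂ × ℂ → ℂ) : Prop :=
  ∀ᶠ z in 𝓝 (0 : ℂ × ℂ), f (z.1 ^ D.n, z.2) = D.eval z.1 z.2

/-- `D` is a (complex) Puiseux factorization of the real analytic germ `f`. An identity of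
convergent power series can be tested on real points. -/
def FactorsReal (D : PuiseuxData) (f : ℝ × ℝ → ℝ) : Prop :=
  ∀ᶠ z in 𝓝 (0 : ℝ × ℝ), ((f (z.1 ^ D.n, z.2) : ℝ) : ℂ) = D.eval (z.1 : ℂ) (z.2 : ℂ)

/-- The root `φ_ν` has leading term `b x ^ a`, that is `b ≠ 0` and `φ_ν = b x ^ a + O(x ^ A)` with
`A > a`. In terms of `t = x ^ (1 / n)` the leading term is `b t ^ k` with `k = n a`. -/
def HasLeadingTerm (D : PuiseuxData) (ν : Fin D.N) (a : ℚ) (b : ℂ) : Prop :=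
  b ≠ 0 ∧ ∃ k : ℕ, (k : ℚ) = D.n * a ∧
    (fun t : ℂ => D.ψ ν t - b * t ^ k) =O[𝓝 0] fun t : ℂ => t ^ (k + 1)

/-- The number of roots, counted with multiplicity, that have leading term `b x ^ a`. -/
def mult (D : PuiseuxData) (a : ℚ) (b : ℂ) : ℕ :=
  {ν : Fin D.N | D.HasLeadingTerm ν a b}.ncard

end PuiseuxData

end NewtonPuiseux

end

open Filter Topology MeasureTheory Asymptotics

noncomputable section

/-! Let `d` be the real dimension of 𝕜 and `T = δ⁻¹`. The claim is that `|f| ^ (-c)` is locally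
integrable for `c * T < d` and not for `c * T > d`.

Divergence: a supporting line of the Newton polyhedron at its diagonal boundary point
(`exists_supporting_line`) gives weights `κ₁ + κ₂ = 1` for which every monomial of `f` has weight at
least `T`. On the box `|x| < ρ s ^ κ₁`, `|y| < ρ s ^ κ₂`, of volume comparable to `s ^ d`, one has
`|f| ≤ M s ^ T`, so the integral is at least a constant times `s ^ (d - c * T)`, which is unbounded
as `s → 0`.

Convergence: here the multiplicities enter. With `x = t ^ n` and leading exponents `k ν`, compare
`f` with its generic size `|x| ^ α * |y| ^ β * ∏ (|y| + |t| ^ k ν)`. This depends only on `|t|` and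
`|y|` and bounds `f` above, so the Cauchy estimates on tori bound each Taylor monomial by it.
Weighted AM-GM passes to the convex hull, whence `|x| ^ T * |y| ^ T ≤ C * (generic size)` for `(T,
T)` in the polyhedron (`exists_rpow_le_genericSize`). Conversely, `f` falls below its generic size
only when `y` is close to some roots. Roots with different leading terms are well separated, so the
close ones share a leading term and number at most `T`; the loss is at most a factor `(z / |y|) ^
T`, where `z` is the distance of `y` to `0` and the roots (`exists_prod_lower_bound`). Together,
`|f| ≥ c |x| ^ T * z ^ T`, which is integrated one variable at a time.

The factorization comes from Newton's algorithm: a Tschirnhaus translation followed by a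
substitution along an edge of the Newton polygon lowers the order in `y`, which yields one root;
dividing it out and inducting yields all of them. The real case is reduced to the complex one by
complexifying the series; real parts of the roots then serve as singular points. -/

/-! ### Double power series and analytic functions of two variables. -/

/-- The function `f` is the sum of the double power series with coefficients `a` on the polydisc of
radius `r`, where the series converges absolutely up to the boundary. -/
structure HasDoubleSeries {𝕜 : Type*} [NontriviallyNormedField 𝕜] (f : 𝕜 × 𝕜 → 𝕜)
    (a : ℕ × ℕ → 𝕜) (r : ℝ) : Prop where
  r_pos : 0 < r
  summable : Summable fun m : ℕ × ℕ => ‖a m‖ * r ^ (m.1 + m.2)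
  hasSum : ∀ x y : 𝕜, ‖x‖ < r → ‖y‖ < r → HasSum (fun m => a m * (x ^ m.1 * y ^ m.2)) (f (x, y))

section DoubleSeries

variable {𝕜 : Type*} [NontriviallyNormedField 𝕜]

theorem norm_mul_pow_mul_pow_le {c x y : 𝕜} {r : ℝ} (hx : ‖x‖ ≤ r) (hy : ‖y‖ ≤ r) (i j : ℕ) :
    ‖c * (x ^ i * y ^ j)‖ ≤ ‖c‖ * r ^ (i + j) := by
  have hr : 0 ≤ r := (norm_nonneg x).trans hx
  rw [norm_mul, norm_mul, norm_pow, norm_pow, pow_add]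
  gcongr

/-- The coefficient of `x ^ i * y ^ j` of a formal multilinear series on `𝕜 × 𝕜`. -/
def doubleCoeff (p : FormalMultilinearSeries 𝕜 (𝕜 × 𝕜) 𝕜) (m : ℕ × ℕ) : 𝕜 :=
  ∑ s : Finset (Fin (m.1 + m.2)) with s.card = m.1,
    p (m.1 + m.2) (s.piecewise (fun _ => (1, 0)) (fun _ => (0, 1)))

theorem norm_doubleCoeff_le (p : FormalMultilinearSeries 𝕜 (𝕜 × 𝕜) 𝕜) (m : ℕ × ℕ) :
    ‖doubleCoeff p m‖ ≤ 2 ^ (m.1 + m.2) * ‖p (m.1 + m.2)‖ := by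
  refine (norm_sum_le _ _).trans ?_
  refine (Finset.sum_le_sum_of_subset_of_nonneg (Finset.filter_subset _ _)
    (fun _ _ _ => norm_nonneg _)).trans ?_
  refine (Finset.sum_le_card_nsmul _ _ ‖p (m.1 + m.2)‖ fun s _ => ?_).trans ?_
  · refine ((p (m.1 + m.2)).le_opNorm _).trans ?_
    refine mul_le_of_le_one_right (norm_nonneg _) (Finset.prod_le_one (fun _ _ => norm_nonneg _) ?_)
    intro i _
    by_cases h : i ∈ s <;> simp [h]
  · simp

/-- Expand `p n` multilinearly at `(x, 0) + (0, y)`: each set of slots that receive `(x, 0)`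
contributes one term, and the terms are grouped by the size of the set. -/
theorem sum_antidiagonal_doubleCoeff (p : FormalMultilinearSeries 𝕜 (𝕜 × 𝕜) 𝕜) (n : ℕ) (x y : 𝕜) :
    ∑ m ∈ Finset.HasAntidiagonal.antidiagonal n, doubleCoeff p m * (x ^ m.1 * y ^ m.2) = p n fun _ => (x, y) := by
  have h1 : (fun _ : Fin n => (x, y)) = (fun _ => (x, 0)) + fun _ => (0, y) := by
    ext i <;> simp
  rw [h1, ContinuousMultilinearMap.map_add_univ]
  have h2 : ∀ s : Finset (Fin n), p n (s.piecewise (fun _ => (x, 0)) fun _ => (0, y)) =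
      x ^ s.card * y ^ (n - s.card) * p n (s.piecewise (fun _ => (1, 0)) (fun _ => (0, 1))) := by
    intro s
    have : (s.piecewise (fun _ : Fin n => (x, (0 : 𝕜))) fun _ => (0, y)) =
        fun i => (s.piecewise (fun _ => x) (fun _ => y)) i •
          (s.piecewise (fun _ : Fin n => ((1 : 𝕜), (0 : 𝕜))) (fun _ => (0, 1))) i := by
      funext i
      by_cases h : i ∈ s <;> simp [h]
    rw [this, ContinuousMultilinearMap.map_smul_univ, smul_eq_mul]
    congr 1
    rw [Finset.prod_piecewise]
    simp [Finset.card_sdiff]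
  simp_rw [h2]
  rw [← Finset.sum_fiberwise_of_maps_to (s := Finset.univ) (t := Finset.HasAntidiagonal.antidiagonal n)
    (g := fun s : Finset (Fin n) => (s.card, n - s.card))]
  · refine Finset.sum_congr rfl fun m hm => ?_
    obtain ⟨i, j⟩ := m
    obtain rfl : i + j = n := Finset.HasAntidiagonal.mem_antidiagonal.1 hm
    simp only [doubleCoeff, Finset.sum_mul]
    refine Finset.sum_congr ?_ fun s hs => ?_
    · ext s
      simp only [Finset.mem_filter, Finset.mem_univ, true_and, Prod.mk.injEq]
      omega
    · simp only [Finset.mem_filter, Finset.mem_univ, true_and, Prod.mk.injEq] at hs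
      rw [hs.1, Nat.add_sub_cancel_left, mul_comm]
  · intro s _
    have := s.card_le_univ
    simp only [Fintype.card_fin] at this
    simp [this]

theorem summable_geometric_prod {q : ℝ} (h0 : 0 ≤ q) (h1 : q < 1) :
    Summable fun m : ℕ × ℕ => q ^ (m.1 + m.2) := by
  simp_rw [pow_add]
  exact (summable_geometric_of_lt_one h0 h1).mul_of_nonneg (summable_geometric_of_lt_one h0 h1)
    (fun _ => pow_nonneg h0 _) (fun _ => pow_nonneg h0 _)

theorem AnalyticAt.exists_hasDoubleSeries [CompleteSpace 𝕜] {f : 𝕜 × 𝕜 → 𝕜}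
    (hf : AnalyticAt 𝕜 f 0) : ∃ a r, HasDoubleSeries f a r := by
  obtain ⟨p, R, hp⟩ := hf
  obtain ⟨ρ, hρ0, hρ⟩ := ENNReal.lt_iff_exists_nnreal_btwn.1 hp.r_pos
  have hρ0' : (0 : ℝ) < ρ := by simpa using hρ0
  obtain ⟨C, hC, hb⟩ := p.norm_mul_pow_le_of_lt_radius (hρ.trans_le hp.r_le)
  -- Each coefficient of total degree `n` is a sum of at most `2 ^ n` terms; a quarter of the radius
  -- absorbs this and leaves a geometric series of ratio `1 / 2`.
  have hr : (0 : ℝ) < ρ / 4 := by positivity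
  have hsum : Summable fun m : ℕ × ℕ => ‖doubleCoeff p m‖ * (ρ / 4 : ℝ) ^ (m.1 + m.2) := by
    refine Summable.of_nonneg_of_le (fun m => by positivity) (fun m => ?_)
      ((summable_geometric_prod (q := 1 / 2) (by norm_num) (by norm_num)).mul_left C)
    calc ‖doubleCoeff p m‖ * (ρ / 4 : ℝ) ^ (m.1 + m.2)
        ≤ 2 ^ (m.1 + m.2) * ‖p (m.1 + m.2)‖ * (ρ / 4 : ℝ) ^ (m.1 + m.2) := by
          gcongr; exact norm_doubleCoeff_le p m
      _ = ‖p (m.1 + m.2)‖ * ρ ^ (m.1 + m.2) * (1 / 2) ^ (m.1 + m.2) := by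
          rw [mul_comm (2 ^ _), mul_assoc, mul_assoc, ← mul_pow, ← mul_pow]; congr 2; ring
      _ ≤ C * (1 / 2) ^ (m.1 + m.2) := by gcongr; exact hb _
  refine ⟨doubleCoeff p, ρ / 4, hr, hsum, fun x y hx hy => ?_⟩
  have hs : Summable fun m : ℕ × ℕ => doubleCoeff p m * (x ^ m.1 * y ^ m.2) :=
    Summable.of_norm_bounded hsum fun m => norm_mul_pow_mul_pow_le hx.le hy.le _ _
  have hxy : (x, y) ∈ Metric.eball (0 : 𝕜 × 𝕜) R := by
    refine Metric.eball_subset_eball hρ.le ?_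
    rw [Metric.eball_coe, Metric.mem_ball, dist_zero_right, Prod.norm_def]
    exact max_lt (by linarith) (by linarith)
  have h1 := hp.hasSum hxy
  rw [zero_add] at h1
  have h2 := hs.hasSum
  rw [← Finset.HasAntidiagonal.sigmaAntidiagonalEquivProd.hasSum_iff] at h2
  have h3 := h2.sigma (fun n => hasSum_fintype _)
  have h4 : ∀ n : ℕ, ∑ m : Finset.HasAntidiagonal.antidiagonal n,
      ((fun m : ℕ × ℕ => doubleCoeff p m * (x ^ m.1 * y ^ m.2)) ∘
        Finset.HasAntidiagonal.sigmaAntidiagonalEquivProd) ⟨n, m⟩ = p n fun _ => (x, y) := by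
    intro n
    rw [← sum_antidiagonal_doubleCoeff, ← Finset.sum_coe_sort (Finset.HasAntidiagonal.antidiagonal n)]
    rfl
  simp_rw [h4] at h3
  rw [h1.unique h3]
  exact hs.hasSum

/-- The formal multilinear series on `𝕜 × 𝕜` with the coefficients `a`. -/
def seriesOfDoubleCoeff (a : ℕ × ℕ → 𝕜) : FormalMultilinearSeries 𝕜 (𝕜 × 𝕜) 𝕜 := fun n =>
  ∑ m ∈ Finset.HasAntidiagonal.antidiagonal n, a m •
    (ContinuousMultilinearMap.mkPiAlgebra 𝕜 (Fin n) 𝕜).compContinuousLinearMap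
      fun k : Fin n => if (k : ℕ) < m.1 then ContinuousLinearMap.fst 𝕜 𝕜 𝕜
        else ContinuousLinearMap.snd 𝕜 𝕜 𝕜

theorem seriesOfDoubleCoeff_apply (a : ℕ × ℕ → 𝕜) (n : ℕ) (x y : 𝕜) :
    (seriesOfDoubleCoeff a n fun _ => (x, y)) =
      ∑ m ∈ Finset.HasAntidiagonal.antidiagonal n, a m * (x ^ m.1 * y ^ m.2) := by
  simp only [seriesOfDoubleCoeff, sum_apply,
    smul_apply, smul_eq_mul]
  refine Finset.sum_congr rfl fun m hm => ?_
  obtain ⟨i, j⟩ := m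
  obtain rfl : i + j = n := Finset.HasAntidiagonal.mem_antidiagonal.1 hm
  congr 1
  rw [ContinuousMultilinearMap.compContinuousLinearMap_apply,
    ContinuousMultilinearMap.mkPiAlgebra_apply, Fin.prod_univ_add]
  simp

theorem norm_seriesOfDoubleCoeff_le (a : ℕ × ℕ → 𝕜) (n : ℕ) :
    ‖seriesOfDoubleCoeff a n‖ ≤ ∑ m ∈ Finset.HasAntidiagonal.antidiagonal n, ‖a m‖ := by
  refine (norm_sum_le _ _).trans (Finset.sum_le_sum fun m _ => ?_)
  rw [norm_smul]
  refine mul_le_of_le_one_right (norm_nonneg _) ?_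
  refine (ContinuousMultilinearMap.norm_compContinuousLinearMap_le _ _).trans ?_
  refine mul_le_one₀ ?_ (Finset.prod_nonneg fun _ _ => norm_nonneg _)
    (Finset.prod_le_one (fun _ _ => norm_nonneg _) ?_)
  · rcases n with _ | n
    · exact (ContinuousMultilinearMap.norm_mkPiAlgebra).le
    · exact (ContinuousMultilinearMap.norm_mkPiAlgebra).le
  · intro k _
    split_ifs
    · exact ContinuousLinearMap.norm_fst_le 𝕜 𝕜 𝕜
    · exact ContinuousLinearMap.norm_snd_le 𝕜 𝕜 𝕜

theorem HasDoubleSeries.analyticAt [CompleteSpace 𝕜] {f : 𝕜 × 𝕜 → 𝕜} {a : ℕ × ℕ → 𝕜} {r : ℝ}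
    (h : HasDoubleSeries f a r) : AnalyticAt 𝕜 f 0 := by
  have hr := h.r_pos
  lift r to NNReal using hr.le
  refine ⟨seriesOfDoubleCoeff a, r, ?_, by simpa using hr, ?_⟩
  · refine FormalMultilinearSeries.le_radius_of_bound _
      (∑' m : ℕ × ℕ, ‖a m‖ * (r : ℝ) ^ (m.1 + m.2)) fun n => ?_
    calc ‖seriesOfDoubleCoeff a n‖ * (r : ℝ) ^ n
        ≤ (∑ m ∈ Finset.HasAntidiagonal.antidiagonal n, ‖a m‖) * (r : ℝ) ^ n := by
          gcongr; exact norm_seriesOfDoubleCoeff_le a n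
      _ = ∑ m ∈ Finset.HasAntidiagonal.antidiagonal n, ‖a m‖ * (r : ℝ) ^ (m.1 + m.2) := by
          rw [Finset.sum_mul]
          refine Finset.sum_congr rfl fun m hm => ?_
          rw [Finset.HasAntidiagonal.mem_antidiagonal.1 hm]
      _ ≤ _ := h.summable.sum_le_tsum _ fun m _ => by positivity
  · rintro ⟨x, y⟩ hxy
    rw [Metric.eball_coe, Metric.mem_ball, dist_zero_right, Prod.norm_def, max_lt_iff] at hxy
    have h2 := h.hasSum x y hxy.1 hxy.2
    rw [← Finset.HasAntidiagonal.sigmaAntidiagonalEquivProd.hasSum_iff] at h2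
    have h3 := h2.sigma (fun n => hasSum_fintype _)
    rw [zero_add]
    convert! h3 using 2 with n
    rw [seriesOfDoubleCoeff_apply, ← Finset.sum_coe_sort (Finset.HasAntidiagonal.antidiagonal n)]
    rfl

theorem hasDoubleSeries_tsum [CompleteSpace 𝕜] {a : ℕ × ℕ → 𝕜} {r : ℝ} (hr : 0 < r)
    (h : Summable fun m : ℕ × ℕ => ‖a m‖ * r ^ (m.1 + m.2)) :
    HasDoubleSeries (fun z : 𝕜 × 𝕜 => ∑' m, a m * (z.1 ^ m.1 * z.2 ^ m.2)) a r :=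
  ⟨hr, h, fun _ _ hx hy => (Summable.of_norm_bounded h fun _ =>
    norm_mul_pow_mul_pow_le hx.le hy.le _ _).hasSum⟩


theorem hasFPowerSeriesAt_ofScalars_of_hasSum {g : 𝕜 → 𝕜} {c : ℕ → 𝕜} {r : ℝ} (hr : 0 < r)
    (h : ∀ y, ‖y‖ < r → HasSum (fun n => c n * y ^ n) (g y)) :
    HasFPowerSeriesAt g (FormalMultilinearSeries.ofScalars 𝕜 c) 0 := by
  rw [hasFPowerSeriesAt_iff]
  filter_upwards [Metric.ball_mem_nhds (0 : 𝕜) hr] with y hy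
  rw [mem_ball_zero_iff] at hy
  simpa [FormalMultilinearSeries.coeff_ofScalars, mul_comm] using h y hy

theorem iteratedDeriv_eq_of_hasSum [CompleteSpace 𝕜] [CharZero 𝕜] {g : 𝕜 → 𝕜} {c : ℕ → 𝕜} {r : ℝ}
    (hr : 0 < r) (h : ∀ y, ‖y‖ < r → HasSum (fun n => c n * y ^ n) (g y)) (n : ℕ) :
    iteratedDeriv n g 0 = n.factorial * c n := by
  have h1 := hasFPowerSeriesAt_ofScalars_of_hasSum hr h
  have h2 := h1.analyticAt.hasFPowerSeriesAt.eq_formalMultilinearSeries h1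
  have h3 : iteratedDeriv n g 0 / n.factorial = c n :=
    congr_fun ((FormalMultilinearSeries.ofScalars_series_injective 𝕜 𝕜) h2) n
  have hn : (n.factorial : 𝕜) ≠ 0 := by exact_mod_cast n.factorial_ne_zero
  rw [← h3]
  field_simp

/-- The coefficient of `y ^ q`, as a function of `x`, of a double power series. -/
def columnSum (a : ℕ × ℕ → 𝕜) (q : ℕ) (x : 𝕜) : 𝕜 := ∑' p, a (p, q) * x ^ p

namespace HasDoubleSeries

variable {f : 𝕜 × 𝕜 → 𝕜} {a : ℕ × ℕ → 𝕜} {r : ℝ}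

theorem summable_column (h : HasDoubleSeries f a r) (q : ℕ) :
    Summable fun p => ‖a (p, q)‖ * r ^ p := by
  have h1 := h.summable.comp_injective (i := fun p : ℕ => (p, q)) (fun _ _ h => (Prod.ext_iff.1 h).1)
  have h2 := h1.mul_right (r ^ q)⁻¹
  refine h2.congr fun p => ?_
  have := (pow_pos h.r_pos q).ne'
  simp only [Function.comp, pow_add]
  field_simp

theorem hasSum_column [CompleteSpace 𝕜] (h : HasDoubleSeries f a r) (q : ℕ) {x : 𝕜} (hx : ‖x‖ < r) :
    HasSum (fun p => a (p, q) * x ^ p) (columnSum a q x) := by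
  refine (Summable.of_norm_bounded (h.summable_column q) fun p => ?_).hasSum
  rw [norm_mul, norm_pow]
  gcongr

theorem hasSum_columns [CompleteSpace 𝕜] (h : HasDoubleSeries f a r) {x y : 𝕜} (hx : ‖x‖ < r)
    (hy : ‖y‖ < r) : HasSum (fun q => columnSum a q x * y ^ q) (f (x, y)) := by
  have h1 := h.hasSum x y hx hy
  rw [← (Equiv.prodComm ℕ ℕ).hasSum_iff] at h1
  refine h1.prod_fiberwise fun q => ?_
  simpa [mul_assoc] using (h.hasSum_column q hx).mul_right (y ^ q)

theorem apply_zero_right [CompleteSpace 𝕜] (h : HasDoubleSeries f a r) {x : 𝕜} (hx : ‖x‖ < r) :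
    f (x, 0) = columnSum a 0 x := by
  have h1 := h.hasSum_columns hx (y := 0) (by simpa using h.r_pos)
  have h2 := hasSum_single (f := fun q => columnSum a q x * 0 ^ q) 0 fun q hq => by simp [hq]
  simpa using h1.unique h2

theorem iteratedDeriv_right [CompleteSpace 𝕜] [CharZero 𝕜] (h : HasDoubleSeries f a r) (q : ℕ)
    {x : 𝕜} (hx : ‖x‖ < r) :
    iteratedDeriv q (fun y => f (x, y)) 0 = q.factorial * columnSum a q x :=
  iteratedDeriv_eq_of_hasSum (c := fun q => columnSum a q x) h.r_pos
    (fun _ hy => h.hasSum_columns hx hy) q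

theorem iteratedDeriv_columnSum [CompleteSpace 𝕜] [CharZero 𝕜] (h : HasDoubleSeries f a r)
    (p q : ℕ) : iteratedDeriv p (columnSum a q) 0 = p.factorial * a (p, q) :=
  iteratedDeriv_eq_of_hasSum (c := fun p => a (p, q)) h.r_pos (fun _ hx => h.hasSum_column q hx) p

/-- Uniqueness of one-variable power series, applied first in `y` and then in `x`. This identifies
the support that defines the Newton polyhedron with the support of any convergent expansion. -/
theorem taylorCoeff_eq [CompleteSpace 𝕜] [CharZero 𝕜] (h : HasDoubleSeries f a r) (p q : ℕ) :
    NewtonPuiseux.taylorCoeff f p q = a (p, q) := by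
  have h1 : (fun x => iteratedDeriv q (fun y => f (x, y)) 0) =ᶠ[𝓝 0]
      fun x => (q.factorial : 𝕜) * columnSum a q x := by
    filter_upwards [Metric.ball_mem_nhds (0 : 𝕜) h.r_pos] with x hx
    exact h.iteratedDeriv_right q (mem_ball_zero_iff.1 hx)
  have h2 : iteratedDeriv p (fun x => (q.factorial : 𝕜) * columnSum a q x) 0 =
      p.factorial * (q.factorial * a (p, q)) :=
    iteratedDeriv_eq_of_hasSum (c := fun p => q.factorial * a (p, q)) h.r_pos
      (fun x hx => by simpa [mul_assoc] using (h.hasSum_column q hx).mul_left (q.factorial : 𝕜)) p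
  rw [NewtonPuiseux.taylorCoeff, h1.iteratedDeriv_eq, h2]
  have hp : (p.factorial : 𝕜) ≠ 0 := by exact_mod_cast p.factorial_ne_zero
  have hq : (q.factorial : 𝕜) ≠ 0 := by exact_mod_cast q.factorial_ne_zero
  field_simp

theorem columnSum_differentiableOn [CompleteSpace 𝕜] (h : HasDoubleSeries f a r) (q : ℕ) :
    DifferentiableOn 𝕜 (columnSum a q) (Metric.ball 0 r) := by
  have hr := h.r_pos
  lift r to NNReal using hr.le
  have h1 : HasFPowerSeriesOnBall (columnSum a q)
      (FormalMultilinearSeries.ofScalars 𝕜 fun p => a (p, q)) 0 r := by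
    refine ⟨FormalMultilinearSeries.le_radius_of_summable _ ?_, by simpa using hr, fun {y} hy => ?_⟩
    · simpa [FormalMultilinearSeries.ofScalars_norm] using h.summable_column q
    · rw [Metric.eball_coe, mem_ball_zero_iff] at hy
      simpa [FormalMultilinearSeries.ofScalars_apply_eq, mul_comm] using h.hasSum_column q hy
  have h2 := h1.differentiableOn
  rwa [Metric.eball_coe] at h2

/-- Shifting the index by `d` in the second variable gives the remainder `f₁`, whose series still
converges on the same polydisc. -/
theorem exists_div_snd_pow [CompleteSpace 𝕜] (h : HasDoubleSeries f a r) (d : ℕ) :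
    ∃ f₁ : 𝕜 × 𝕜 → 𝕜, AnalyticAt 𝕜 f₁ 0 ∧ f₁ (0, 0) = columnSum a d 0 ∧
      ∀ x y, ‖x‖ < r → ‖y‖ < r →
        f (x, y) = ∑ j ∈ Finset.range d, columnSum a j x * y ^ j + y ^ d * f₁ (x, y) := by
  set b : ℕ × ℕ → 𝕜 := fun m => a (m.1, m.2 + d) with hb
  have hs : Summable fun m : ℕ × ℕ => ‖b m‖ * r ^ (m.1 + m.2) := by
    have h1 := h.summable.comp_injective (i := fun m : ℕ × ℕ => (m.1, m.2 + d))
      (fun m m' h => by simpa [Prod.ext_iff] using h)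
    refine (h1.mul_right (r ^ d)⁻¹).congr fun m => ?_
    have := (pow_pos h.r_pos d).ne'
    simp only [Function.comp, hb, ← add_assoc, pow_add _ _ d]
    field_simp
  have hg := hasDoubleSeries_tsum h.r_pos hs
  refine ⟨_, hg.analyticAt, ?_, fun x y hx hy => ?_⟩
  · rw [hg.apply_zero_right (by simpa using h.r_pos)]
    simp [columnSum, hb]
  have h1 := h.hasSum_columns hx hy
  have h2 := (hg.hasSum_columns hx hy).mul_left (y ^ d)
  have h3 := (hasSum_nat_add_iff d (f := fun q => columnSum a q x * y ^ q)).1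
    (h2.congr_fun fun q => by simp only [hb, columnSum]; ring)
  rw [h1.unique h3, add_comm]

theorem analyticAt_columnSum [CompleteSpace 𝕜] (h : HasDoubleSeries f a r) (q : ℕ) :
    AnalyticAt 𝕜 (columnSum a q) 0 :=
  (hasFPowerSeriesAt_ofScalars_of_hasSum h.r_pos fun _ hx => h.hasSum_column q hx).analyticAt

theorem exists_div_fst_pow [CompleteSpace 𝕜] (h : HasDoubleSeries f a r) (k : ℕ)
    (hk : ∀ p < k, ∀ q, a (p, q) = 0) :
    ∃ g : 𝕜 × 𝕜 → 𝕜, HasDoubleSeries g (fun m => a (m.1 + k, m.2)) r ∧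
      ∀ x y, ‖x‖ < r → ‖y‖ < r → f (x, y) = x ^ k * g (x, y) := by
  have hi : Function.Injective fun m : ℕ × ℕ => (m.1 + k, m.2) :=
    fun m m' h => by simpa [Prod.ext_iff] using h
  have hs : Summable fun m : ℕ × ℕ => ‖a (m.1 + k, m.2)‖ * r ^ (m.1 + m.2) := by
    refine ((h.summable.comp_injective hi).mul_right (r ^ k)⁻¹).congr fun m => ?_
    have := (pow_pos h.r_pos k).ne'
    simp only [Function.comp, add_right_comm _ k, pow_add _ _ k]
    field_simp
  have hg := hasDoubleSeries_tsum h.r_pos hs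
  refine ⟨_, hg, fun x y hx hy => ?_⟩
  have h1 := h.hasSum x y hx hy
  rw [← hi.hasSum_iff] at h1
  · refine h1.unique ?_
    convert! (hg.hasSum x y hx hy).mul_left (x ^ k) using 2 with m
    simp only [Function.comp]
    ring
  · rintro ⟨p, q⟩ hm
    have : p < k := by
      by_contra! hp
      exact hm ⟨(p - k, q), by simp [Nat.sub_add_cancel hp]⟩
    simp [hk p this q]

end HasDoubleSeries

theorem AnalyticAt.exists_div_snd_pow [CompleteSpace 𝕜] [CharZero 𝕜] {f : 𝕜 × 𝕜 → 𝕜}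
    (hf : AnalyticAt 𝕜 f 0) (d : ℕ) :
    ∃ (A : ℕ → 𝕜 → 𝕜) (f₁ : 𝕜 × 𝕜 → 𝕜), (∀ j, AnalyticAt 𝕜 (A j) 0) ∧ AnalyticAt 𝕜 f₁ 0 ∧
      (∀ j, ∀ᶠ x in 𝓝 0, iteratedDeriv j (fun y => f (x, y)) 0 = j.factorial * A j x) ∧
      f₁ (0, 0) = A d 0 ∧
      ∀ᶠ z in 𝓝 (0 : 𝕜 × 𝕜), f z = ∑ j ∈ Finset.range d, A j z.1 * z.2 ^ j + z.2 ^ d * f₁ z := by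
  obtain ⟨a, r, h⟩ := hf.exists_hasDoubleSeries
  obtain ⟨f₁, h1, h2, h3⟩ := h.exists_div_snd_pow d
  refine ⟨columnSum a, f₁, h.analyticAt_columnSum, h1, fun j => ?_, h2, ?_⟩
  · filter_upwards [Metric.ball_mem_nhds (0 : 𝕜) h.r_pos] with x hx
    exact h.iteratedDeriv_right j (mem_ball_zero_iff.1 hx)
  · filter_upwards [Metric.ball_mem_nhds (0 : 𝕜 × 𝕜) h.r_pos] with z hz
    rw [mem_ball_zero_iff, Prod.norm_def, max_lt_iff] at hz
    exact h3 z.1 z.2 hz.1 hz.2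

theorem AnalyticAt.exists_div_snd [CompleteSpace 𝕜] [CharZero 𝕜] {f : 𝕜 × 𝕜 → 𝕜}
    (hf : AnalyticAt 𝕜 f 0) (h0 : ∀ᶠ x in 𝓝 (0 : 𝕜), f (x, 0) = 0) :
    ∃ f₁ : 𝕜 × 𝕜 → 𝕜, AnalyticAt 𝕜 f₁ 0 ∧ ∀ᶠ z in 𝓝 (0 : 𝕜 × 𝕜), f z = z.2 * f₁ z := by
  obtain ⟨A, f₁, -, h1, hA, -, h⟩ := hf.exists_div_snd_pow 1
  refine ⟨f₁, h1, ?_⟩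
  have ht : Tendsto Prod.fst (𝓝 (0 : 𝕜 × 𝕜)) (𝓝 0) := continuous_fst.tendsto _
  filter_upwards [h, ht.eventually h0, ht.eventually (hA 0)] with z hz hz0 hzA
  simp only [iteratedDeriv_zero, Nat.factorial_zero, Nat.cast_one, one_mul] at hzA
  simpa [← hzA, hz0] using hz

theorem AnalyticAt.exists_eq_fst_pow_mul [CompleteSpace 𝕜] {f : 𝕜 × 𝕜 → 𝕜} (hf : AnalyticAt 𝕜 f 0)
    (h0 : ¬ ∀ᶠ z in 𝓝 (0 : 𝕜 × 𝕜), f z = 0) :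
    ∃ (k : ℕ) (g : 𝕜 × 𝕜 → 𝕜), AnalyticAt 𝕜 g 0 ∧ (¬ ∀ᶠ y in 𝓝 (0 : 𝕜), g (0, y) = 0) ∧
      ∀ᶠ z in 𝓝 (0 : 𝕜 × 𝕜), f z = z.1 ^ k * g z := by
  classical
  obtain ⟨a, r, h⟩ := hf.exists_hasDoubleSeries
  have hball := Metric.ball_mem_nhds (0 : 𝕜 × 𝕜) h.r_pos
  have hex : ∃ p, ∃ q, a (p, q) ≠ 0 := by
    by_contra! hex
    refine h0 ?_
    filter_upwards [hball] with z hz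
    rw [mem_ball_zero_iff, Prod.norm_def, max_lt_iff] at hz
    refine (h.hasSum z.1 z.2 hz.1 hz.2).unique ?_
    simp [hex, hasSum_zero]
  obtain ⟨q, hq⟩ := Nat.find_spec hex
  obtain ⟨g, hg, hfg⟩ := h.exists_div_fst_pow (Nat.find hex) fun p hp q => by
    have := Nat.find_min hex hp
    push Not at this
    exact this q
  -- The exponent is the least `p` whose row of coefficients is nonzero; this row is the Taylor
  -- series of `g (0, ·)`.
  refine ⟨Nat.find hex, g, hg.analyticAt, fun hz => hq ?_, ?_⟩
  · have h1 : ∀ y : 𝕜, ‖y‖ < r → HasSum (fun q => a (Nat.find hex, q) * y ^ q) (g (0, y)) := by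
      intro y hy
      refine (hg.hasSum_columns (x := 0) (by simpa using h.r_pos) hy).congr_fun fun q => ?_
      congr 1
      rw [columnSum, tsum_eq_single 0 fun p hp => by simp [hp]]
      simp
    have h2 := (hasFPowerSeriesAt_ofScalars_of_hasSum h.r_pos h1).eq_zero_of_eventually hz
    exact congr_fun (FormalMultilinearSeries.ofScalars_series_eq_zero 𝕜 |>.1 h2) q
  · filter_upwards [hball] with z hz
    rw [mem_ball_zero_iff, Prod.norm_def, max_lt_iff] at hz
    exact hfg z.1 z.2 hz.1 hz.2

end DoubleSeries

/-! ### Complexification and the identity theorem on real points. -/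

theorem HasDoubleSeries.exists_complexification {f : ℝ × ℝ → ℝ} {a : ℕ × ℕ → ℝ} {r : ℝ}
    (h : HasDoubleSeries f a r) :
    ∃ F : ℂ × ℂ → ℂ, HasDoubleSeries F (fun m => (a m : ℂ)) r ∧
      ∀ x y : ℝ, |x| < r → |y| < r → F (x, y) = f (x, y) := by
  have hs : Summable fun m : ℕ × ℕ => ‖(a m : ℂ)‖ * r ^ (m.1 + m.2) := by simpa using h.summable
  refine ⟨_, hasDoubleSeries_tsum h.r_pos hs, fun x y hx hy => ?_⟩
  have h1 := (Complex.hasSum_ofReal).2 (h.hasSum x y hx hy)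
  rw [← h1.tsum_eq]
  simp

/-- A function that is holomorphic on a disc and vanishes on its real diameter is zero. -/
theorem eqOn_zero_of_forall_real {g : ℂ → ℂ} {r : ℝ} (hr : 0 < r)
    (hg : AnalyticOnNhd ℂ g (Metric.ball 0 r)) (h : ∀ x : ℝ, |x| < r → g x = 0) :
    ∀ z : ℂ, ‖z‖ < r → g z = 0 := by
  have h0 : (0 : ℂ) ∈ Metric.ball (0 : ℂ) r := by simpa using hr
  have h1 : ∃ᶠ z in 𝓝[≠] (0 : ℂ), g z = 0 := by
    have ht : Tendsto (fun x : ℝ => (x : ℂ)) (𝓝[≠] 0) (𝓝[≠] 0) := by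
      refine tendsto_nhdsWithin_of_tendsto_nhds_of_eventually_within _ ?_ ?_
      · exact (Complex.continuous_ofReal.tendsto' 0 0 (by simp)).mono_left nhdsWithin_le_nhds
      · filter_upwards [self_mem_nhdsWithin] with x hx
        simpa using hx
    refine ht.frequently (Eventually.frequently ?_)
    filter_upwards [nhdsWithin_le_nhds (Metric.ball_mem_nhds (0 : ℝ) hr)] with x hx
    exact h x (by simpa using hx)
  intro z hz
  exact hg.eqOn_zero_of_preconnected_of_frequently_eq_zero
    (convex_ball _ _).isPreconnected h0 h1 (by simpa using hz)

/-- The one-variable identity theorem is applied twice: in `x` for each fixed real `y`, then in `y`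
for each fixed complex `x`. -/
theorem AnalyticAt.eventually_eq_zero_of_real {G : ℂ × ℂ → ℂ} (hG : AnalyticAt ℂ G 0)
    (h : ∀ᶠ z in 𝓝 (0 : ℝ × ℝ), G (z.1, z.2) = 0) : ∀ᶠ z in 𝓝 (0 : ℂ × ℂ), G z = 0 := by
  obtain ⟨r₁, hr₁, h1⟩ := Metric.eventually_nhds_iff_ball.1 hG.eventually_analyticAt
  obtain ⟨r₂, hr₂, h2⟩ := Metric.eventually_nhds_iff_ball.1 h
  set r := min r₁ r₂
  have hr : 0 < r := lt_min hr₁ hr₂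
  have hA : ∀ x y : ℂ, ‖x‖ < r → ‖y‖ < r → AnalyticAt ℂ G (x, y) := fun x y hx hy => by
    refine h1 _ ?_
    rw [mem_ball_zero_iff, Prod.norm_def]
    exact max_lt (hx.trans_le (min_le_left _ _)) (hy.trans_le (min_le_left _ _))
  have hR : ∀ x y : ℝ, |x| < r → |y| < r → G (x, y) = 0 := fun x y hx hy => by
    refine h2 (x, y) ?_
    rw [mem_ball_zero_iff, Prod.norm_def]
    exact max_lt (hx.trans_le (min_le_right _ _)) (hy.trans_le (min_le_right _ _))
  have hC : ∀ y : ℝ, |y| < r → ∀ x : ℂ, ‖x‖ < r → G (x, y) = 0 := fun y hy =>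
    eqOn_zero_of_forall_real hr (fun x hx =>
      (hA x y (by simpa using hx) (by simpa using hy)).comp₂ analyticAt_id analyticAt_const)
      fun x hx => hR x y hx hy
  have hCC : ∀ x : ℂ, ‖x‖ < r → ∀ y : ℂ, ‖y‖ < r → G (x, y) = 0 := fun x hx =>
    eqOn_zero_of_forall_real hr (fun y hy =>
      (hA x y hx (by simpa using hy)).comp₂ analyticAt_const analyticAt_id)
      fun y hy => hC y hy x hx
  filter_upwards [Metric.ball_mem_nhds (0 : ℂ × ℂ) hr] with z hz
  rw [mem_ball_zero_iff, Prod.norm_def, max_lt_iff] at hz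
  exact hCC z.1 hz.1 z.2 hz.2

/-! ### Newton's algorithm: existence of one Puiseux root. -/

open scoped ContDiff in
/-- The analytic implicit function theorem for a scalar equation at the origin. -/
theorem AnalyticAt.exists_implicit {G : ℂ × ℂ → ℂ} (hG : AnalyticAt ℂ G 0) (h0 : G 0 = 0)
    (h1 : deriv (fun y => G (0, y)) 0 ≠ 0) :
    ∃ τ : ℂ → ℂ, AnalyticAt ℂ τ 0 ∧ τ 0 = 0 ∧ ∀ᶠ x in 𝓝 (0 : ℂ), G (x, τ x) = 0 := by
  have cdf : ContDiffAt ℂ ω G 0 := hG.contDiffAt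
  have hd : fderiv ℂ G 0 (0, 1) = deriv (fun y => G (0, y)) 0 := by
    have h2 : HasFDerivAt G (fderiv ℂ G 0) ((0 : ℂ), (0 : ℂ)) :=
      hG.differentiableAt.hasFDerivAt
    have h3 : HasDerivAt (fun y : ℂ => ((0 : ℂ), y)) ((0 : ℂ), (1 : ℂ)) 0 :=
      (hasDerivAt_const (0 : ℂ) (0 : ℂ)).prodMk (hasDerivAt_id (0 : ℂ))
    exact (h2.comp_hasDerivAt (0 : ℂ) h3).deriv.symm
  have hinv : (fderiv ℂ G 0 ∘L .inr ℂ ℂ ℂ).IsInvertible := by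
    refine ⟨ContinuousLinearEquiv.unitsEquivAut ℂ (Units.mk0 _ h1), ?_⟩
    ext
    simp [hd]
  have pn : (ω : WithTop ℕ∞) ≠ 0 := by simp
  refine ⟨cdf.implicitFunction pn hinv, (cdf.contDiffAt_implicitFunction pn hinv).analyticAt,
    cdf.implicitFunction_apply_self pn hinv, ?_⟩
  simpa [h0] using cdf.eventually_apply_implicitFunction pn hinv

theorem AnalyticAt.deriv_snd {g : ℂ × ℂ → ℂ} (hg : AnalyticAt ℂ g 0) :
    AnalyticAt ℂ (fun z : ℂ × ℂ => deriv (fun y => g (z.1, y)) z.2) 0 := by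
  have h1 : AnalyticAt ℂ (fun z => fderiv ℂ g z ((0 : ℂ), (1 : ℂ))) 0 :=
    ((ContinuousLinearMap.apply ℂ ℂ ((0 : ℂ), (1 : ℂ))).analyticAt _).comp hg.fderiv
  refine h1.congr ?_
  filter_upwards [hg.eventually_analyticAt] with z hz
  have h2 : HasFDerivAt g (fderiv ℂ g z) (z.1, z.2) := hz.differentiableAt.hasFDerivAt
  have h3 : HasDerivAt (fun y : ℂ => (z.1, y)) ((0 : ℂ), (1 : ℂ)) z.2 :=
    (hasDerivAt_const z.2 z.1).prodMk (hasDerivAt_id z.2)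
  exact (h2.comp_hasDerivAt z.2 h3).deriv.symm

theorem AnalyticAt.iteratedDeriv_snd {g : ℂ × ℂ → ℂ} (hg : AnalyticAt ℂ g 0) (j : ℕ) :
    AnalyticAt ℂ (fun z : ℂ × ℂ => iteratedDeriv j (fun y => g (z.1, y)) z.2) 0 := by
  induction j generalizing g with
  | zero => simpa using hg
  | succ j ih =>
    simp_rw [iteratedDeriv_succ']
    exact ih hg.deriv_snd

/-- An analytic function of order `d` in `y` becomes, by a translation in `y`, one whose
coefficient of `y ^ (d - 1)` vanishes. -/
theorem AnalyticAt.exists_tschirnhaus {g : ℂ × ℂ → ℂ} (hg : AnalyticAt ℂ g 0) {d : ℕ}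
    (hd : 0 < d) (hord : analyticOrderAt (fun y => g (0, y)) 0 = d) :
    ∃ τ : ℂ → ℂ, AnalyticAt ℂ τ 0 ∧ τ 0 = 0 ∧
      ∀ᶠ x in 𝓝 (0 : ℂ), iteratedDeriv (d - 1) (fun y => g (x, y + τ x)) 0 = 0 := by
  have hg0 : AnalyticAt ℂ (fun y => g (0, y)) 0 :=
    AnalyticAt.comp₂ (h := g) hg analyticAt_const analyticAt_id
  obtain ⟨h1, h2⟩ := (analyticOrderAt_eq_nat_iff_iteratedDeriv_eq_zero hg0).1 hord
  -- The curve `τ` solves `∂_y ^ (d - 1) g = 0`; its `y`-derivative at the origin is `∂_y ^ d g`,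
  -- nonzero because the order is exactly `d`.
  have h3 : deriv (fun y => iteratedDeriv (d - 1) (fun y => g (0, y)) y) 0 ≠ 0 := by
    rw [← iteratedDeriv_succ, Nat.sub_add_cancel hd]
    exact h2
  obtain ⟨τ, ha, hz, hτ⟩ := (hg.iteratedDeriv_snd (d - 1)).exists_implicit
    (h1 (d - 1) (by omega)) h3
  refine ⟨τ, ha, hz, ?_⟩
  filter_upwards [hτ] with x hx
  rw [iteratedDeriv_comp_add_const (f := fun y => g (x, y))]
  simpa using hx

/-- A polynomial with vanishing subleading coefficient and some other nonzero coefficient below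
the leading one has a root that is not of full multiplicity. -/
theorem exists_root_of_nextCoeff_eq_zero {P : Polynomial ℂ} {d : ℕ} (hd : P.natDegree = d)
    (hd0 : 0 < d) (h1 : P.coeff (d - 1) = 0) {j : ℕ} (hj : j < d) (hPj : P.coeff j ≠ 0) :
    ∃ c, 0 < P.rootMultiplicity c ∧ P.rootMultiplicity c < d := by
  have hP : P ≠ 0 := fun h => by simp [h] at hPj
  obtain ⟨c, hc⟩ := Complex.exists_root (f := P) (by
    rw [Polynomial.degree_eq_natDegree hP, hd]; exact_mod_cast hd0)
  refine ⟨c, (Polynomial.rootMultiplicity_pos hP).2 hc, ?_⟩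
  by_contra! hcon
  have hdvd : (Polynomial.X - Polynomial.C c) ^ d ∣ P :=
    (Polynomial.le_rootMultiplicity_iff hP).1 hcon
  have hPeq := Polynomial.eq_leadingCoeff_mul_of_monic_of_dvd_of_natDegree_le
    ((Polynomial.monic_X_sub_C c).pow d) hdvd (by simp [hd])
  have hlc : P.leadingCoeff ≠ 0 := Polynomial.leadingCoeff_ne_zero.2 hP
  have hcoeff : ∀ i, P.coeff i = P.leadingCoeff * ((-c) ^ (d - i) * (d.choose i : ℂ)) := by
    intro i
    conv_lhs => rw [hPeq]
    rw [Polynomial.coeff_C_mul, sub_eq_add_neg, ← Polynomial.C_neg, Polynomial.coeff_X_add_C_pow]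
  -- If `c` had multiplicity `d`, then `P` would be a multiple of `(X - c) ^ d`, with subleading
  -- coefficient proportional to `d * c`. So `c = 0` and `P` is a monomial, contradicting `hPj`.
  have hc0 : c = 0 := by
    have h2 := hcoeff (d - 1)
    rw [h1, Nat.choose_symm (by omega : 1 ≤ d), show d - (d - 1) = 1 by omega] at h2
    have : (d : ℂ) ≠ 0 := by exact_mod_cast hd0.ne'
    simpa [hlc, this, eq_comm] using h2
  exact hPj (by rw [hcoeff j, hc0, neg_zero, zero_pow (by omega)]; simp)

/-- Minimizing `o j / (d - j)` selects the edge of the Newton polygon that issues from the vertex of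
`y ^ d`. The conclusion is cross-multiplied so that it can be used with natural-number exponents. -/
theorem exists_min_slope {S : Finset ℕ} {d : ℕ} (hS : S.Nonempty) (hd : ∀ j ∈ S, j < d)
    (o : ℕ → ℕ) : ∃ i ∈ S, ∀ j ∈ S, o i * (d - j) ≤ (d - i) * o j := by
  obtain ⟨i, hi, h⟩ := S.exists_min_image (fun j => (o j : ℚ) / ((d - j : ℕ) : ℚ)) hS
  refine ⟨i, hi, fun j hj => ?_⟩
  have h1 : (0 : ℚ) < ((d - i : ℕ) : ℚ) := by exact_mod_cast Nat.sub_pos_of_lt (hd i hi)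
  have h2 : (0 : ℚ) < ((d - j : ℕ) : ℚ) := by exact_mod_cast Nat.sub_pos_of_lt (hd j hj)
  have h3 := h j hj
  rw [div_le_div_iff₀ h1 h2] at h3
  rw [mul_comm (d - i)]
  exact_mod_cast h3

/-- A zero germ is given the factor `u = 0`, so that the single value `u 0` decides whether the germ
vanishes. -/
theorem AnalyticAt.exists_eq_pow_mul_or_zero {A : ℂ → ℂ} (hA : AnalyticAt ℂ A 0) :
    ∃ (o : ℕ) (u : ℂ → ℂ), AnalyticAt ℂ u 0 ∧ (∀ᶠ x in 𝓝 0, A x = x ^ o * u x) ∧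
      (u 0 = 0 → ∀ x, u x = 0) := by
  by_cases h : ∀ᶠ x in 𝓝 0, A x = 0
  · exact ⟨0, fun _ => 0, analyticAt_const, by simpa using h, fun _ _ => rfl⟩
  · obtain ⟨o, u, hu, hu0, hAu⟩ := hA.exists_eventuallyEq_pow_smul_nonzero_iff.2 h
    exact ⟨o, u, hu, by simpa using hAu, fun h => absurd h hu0⟩

theorem eq_zero_of_eventually_pow_mul_eq_zero {u : ℂ → ℂ} (hu : ContinuousAt u 0) {o : ℕ}
    (h : ∀ᶠ x in 𝓝 (0 : ℂ), x ^ o * u x = 0) : u 0 = 0 := by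
  by_contra h0
  have h1 : ∀ᶠ x in 𝓝[≠] (0 : ℂ), False := by
    filter_upwards [nhdsWithin_le_nhds h, nhdsWithin_le_nhds (hu.eventually_ne h0),
      self_mem_nhdsWithin] with x hx hx1 hx2
    exact mul_ne_zero (pow_ne_zero _ hx2) hx1 hx
  exact h1.exists.elim fun _ h => h

theorem analyticOrderAt_eval_add {P : Polynomial ℂ} (hP : P ≠ 0) (c : ℂ) :
    analyticOrderAt (fun w => P.eval (c + w)) 0 = P.rootMultiplicity c := by
  have ha : ∀ Q : Polynomial ℂ, AnalyticAt ℂ (fun w => Q.eval (c + w)) 0 := fun Q =>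
    (Q.differentiable.comp (differentiable_id.const_add c)).analyticAt 0
  obtain ⟨Q, hQ, hdvd⟩ := P.exists_eq_pow_rootMultiplicity_mul_and_not_dvd hP c
  refine (ha P).analyticOrderAt_eq_natCast.2 ⟨fun w => Q.eval (c + w), ha Q, ?_, ?_⟩
  · simpa [Polynomial.dvd_iff_isRoot] using hdvd
  · refine Eventually.of_forall fun w => ?_
    conv_lhs => rw [hQ]
    simp

/-- The substitution `x = t ^ m`, `y = t ^ k * w` along an edge of the Newton polygon. -/
theorem AnalyticAt.exists_newton_step {g : ℂ × ℂ → ℂ} (hg : AnalyticAt ℂ g 0) {d : ℕ}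
    (hd : 0 < d) (hord : analyticOrderAt (fun y => g (0, y)) 0 = d)
    (hT : ∀ᶠ x in 𝓝 (0 : ℂ), iteratedDeriv (d - 1) (fun y => g (x, y)) 0 = 0)
    (h0 : ¬ ∀ᶠ x in 𝓝 (0 : ℂ), g (x, 0) = 0) :
    ∃ (m k e : ℕ) (c : ℂ) (h : ℂ × ℂ → ℂ), 0 < m ∧ 0 < k ∧ 0 < e ∧ e < d ∧
      AnalyticAt ℂ h 0 ∧ analyticOrderAt (fun w => h (0, w)) 0 = e ∧
      ∀ᶠ z in 𝓝 (0 : ℂ × ℂ), g (z.1 ^ m, z.1 ^ k * (c + z.2)) = z.1 ^ (k * d) * h z := by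
  classical
  obtain ⟨A, G, hA, hG, hAder, hG0, hdec⟩ := hg.exists_div_snd_pow d
  have hg0 : AnalyticAt ℂ (fun y => g (0, y)) 0 :=
    AnalyticAt.comp₂ (h := g) hg analyticAt_const analyticAt_id
  obtain ⟨hlow, htop⟩ := (analyticOrderAt_eq_nat_iff_iteratedDeriv_eq_zero hg0).1 hord
  have hfac : ∀ j : ℕ, (j.factorial : ℂ) ≠ 0 := fun j => by exact_mod_cast j.factorial_ne_zero
  have hA0 : ∀ j < d, A j 0 = 0 := fun j hj => by
    have := (hAder j).self_of_nhds
    rw [hlow j hj] at this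
    simpa [hfac j] using this.symm
  have hAd : A d 0 ≠ 0 := fun h => htop (by simpa [h] using (hAder d).self_of_nhds)
  choose o u hu hAu hu0 using fun j => (hA j).exists_eq_pow_mul_or_zero
  set S : Finset ℕ := {j ∈ Finset.range d | u j 0 ≠ 0} with hSdef
  have hmem : ∀ j, j ∈ S ↔ j < d ∧ u j 0 ≠ 0 := fun j => by simp [hSdef]
  have hS : S.Nonempty := by
    refine ⟨0, (hmem 0).2 ⟨hd, fun hu00 => h0 ?_⟩⟩
    filter_upwards [hAder 0, hAu 0] with x hx hx'
    simpa [hx', hu0 0 hu00 x] using hx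
  obtain ⟨i, hiS, hmin⟩ := exists_min_slope hS (fun j hj => ((hmem j).1 hj).1) o
  obtain ⟨hid, hui⟩ := (hmem i).1 hiS
  set m := d - i with hm
  set k := o i with hk
  have hm0 : 0 < m := Nat.sub_pos_of_lt hid
  have hk0 : 0 < k := by
    by_contra! hk0
    have := (hAu i).self_of_nhds
    rw [hA0 i hid, ← hk, Nat.le_zero.1 hk0] at this
    exact hui (by simpa using this.symm)
  -- What remains of `A j (t ^ m)` after division by `t ^ (k * (d - j))`. For `j ∈ S` the minimality
  -- of the slope makes the subtraction exact; for other `j < d` the factor `u j` is zero and the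
  -- exponent is irrelevant.
  set b : ℕ → ℂ → ℂ := fun j t => t ^ (m * o j - k * (d - j)) * u j (t ^ m) with hb
  have hpow : AnalyticAt ℂ (fun t : ℂ => t ^ m) 0 := analyticAt_id.pow m
  have hpow0 : (0 : ℂ) ^ m = 0 := zero_pow hm0.ne'
  have hba : ∀ j, AnalyticAt ℂ (b j) 0 := fun j => by
    refine (analyticAt_id.pow _).mul (AnalyticAt.fun_comp (g := u j) ?_ hpow)
    rw [hpow0]
    exact hu j
  have htm : Tendsto (fun t : ℂ => t ^ m) (𝓝 0) (𝓝 0) := by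
    simpa [hpow0] using hpow.continuousAt.tendsto
  have hAb : ∀ j < d, ∀ᶠ t in 𝓝 (0 : ℂ), A j (t ^ m) = t ^ (k * (d - j)) * b j t := by
    intro j hj
    filter_upwards [htm.eventually (hAu j)] with t ht
    rw [ht, hb]
    by_cases hju : u j 0 = 0
    · simp [hu0 j hju]
    · have h1 := hmin j ((hmem j).2 ⟨hj, hju⟩)
      simp only
      rw [← mul_assoc, ← pow_add, Nat.add_sub_cancel' h1, pow_mul]
  have hbi : b i 0 ≠ 0 := by
    have h1 : m * o i - k * (d - i) = 0 := by rw [← hk, ← hm, mul_comm, Nat.sub_self]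
    simp only [hb, h1, hpow0]
    simpa using hui
  have hbd : b (d - 1) 0 = 0 := by
    have h1 : u (d - 1) 0 = 0 := by
      refine eq_zero_of_eventually_pow_mul_eq_zero (o := o (d - 1)) (hu (d - 1)).continuousAt ?_
      filter_upwards [hT, hAder (d - 1), hAu (d - 1)] with x h1 h2 h3
      rw [h1] at h2
      rw [← h3]
      simpa [hfac] using h2.symm
    simp only [hb, hpow0, h1, mul_zero]
  set β : ℕ → ℂ := fun j => if j < d then b j 0 else A d 0 with hβ
  -- The edge polynomial. Its degree is `d`, its coefficient at `i` is nonzero, and its subleading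
  -- coefficient vanishes by `hT`, so it has a root of multiplicity less than `d`.
  set P : Polynomial ℂ := ∑ j ∈ Finset.range (d + 1), Polynomial.C (β j) * Polynomial.X ^ j with hP
  have hcoeff : ∀ j, P.coeff j = if j < d + 1 then β j else 0 := fun j => by
    simp [hP, Polynomial.finsetSum_coeff, Polynomial.coeff_C_mul, Polynomial.coeff_X_pow]
  have hdeg : P.natDegree = d := by
    refine Polynomial.natDegree_eq_of_le_of_coeff_ne_zero ?_ ?_
    · refine Polynomial.natDegree_le_iff_coeff_eq_zero.2 fun j hj => ?_
      rw [hcoeff, if_neg (by omega)]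
    · rw [hcoeff, if_pos (by omega)]
      simpa [hβ] using hAd
  obtain ⟨c, hc1, hc2⟩ := exists_root_of_nextCoeff_eq_zero hdeg hd
    (by rw [hcoeff, if_pos (by omega), hβ]; simpa [hd] using hbd) hid
    (by rw [hcoeff, if_pos (by omega), hβ]; simpa [hid] using hbi)
  set h : ℂ × ℂ → ℂ := fun z => ∑ j ∈ Finset.range d, b j z.1 * (c + z.2) ^ j +
    (c + z.2) ^ d * G (z.1 ^ m, z.1 ^ k * (c + z.2)) with hh
  have hk00 : (0 : ℂ) ^ k = 0 := zero_pow hk0.ne'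
  have hmap : AnalyticAt ℂ (fun z : ℂ × ℂ => (z.1 ^ m, z.1 ^ k * (c + z.2))) 0 :=
    (analyticAt_fst.pow m).prod ((analyticAt_fst.pow k).mul (analyticAt_const.add analyticAt_snd))
  have hmap0 : ((0 : ℂ × ℂ).1 ^ m, (0 : ℂ × ℂ).1 ^ k * (c + (0 : ℂ × ℂ).2)) = (0 : ℂ × ℂ) := by
    simp [hpow0, hk00]
  have hP0 : P ≠ 0 := fun h => by simp [h] at hdeg; omega
  refine ⟨m, k, P.rootMultiplicity c, c, h, hm0, hk0, hc1, hc2, ?_, ?_, ?_⟩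
  · refine AnalyticAt.add ?_ ?_
    · refine Finset.analyticAt_fun_sum _ fun j _ => ?_
      exact (AnalyticAt.fun_comp (g := b j) (f := Prod.fst) (x := (0 : ℂ × ℂ)) (hba j)
        analyticAt_fst).mul
        ((analyticAt_const.add analyticAt_snd).pow j)
    · refine ((analyticAt_const.add analyticAt_snd).pow d).mul (AnalyticAt.fun_comp (g := G) ?_ hmap)
      rw [hmap0]
      exact hG
  -- On `t = 0` the function `h` is `P (c + w)`, so its order there is the multiplicity of the root
  -- `c`.
  · rw [← analyticOrderAt_eval_add hP0 c]
    congr 1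
    funext w
    simp only [hh, hP, hpow0, hk00, zero_mul, hG0, Polynomial.eval_finsetSum, Polynomial.eval_add,
      Finset.sum_range_succ, Polynomial.eval_mul, Polynomial.eval_C, Polynomial.eval_pow,
      Polynomial.eval_X]
    congr 1
    · refine Finset.sum_congr rfl fun j hj => ?_
      simp [hβ, Finset.mem_range.1 hj]
    · simp [hβ, mul_comm]
  · have ht : Tendsto (fun z : ℂ × ℂ => (z.1 ^ m, z.1 ^ k * (c + z.2))) (𝓝 0) (𝓝 0) := by
      simpa only [ContinuousAt, hmap0] using hmap.continuousAt
    have hf : Tendsto Prod.fst (𝓝 (0 : ℂ × ℂ)) (𝓝 0) := continuous_fst.tendsto _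
    have hAb' : ∀ᶠ t in 𝓝 (0 : ℂ), ∀ j ∈ Finset.range d, A j (t ^ m) = t ^ (k * (d - j)) * b j t :=
      (Finset.eventually_all _).2 fun j hj => hAb j (Finset.mem_range.1 hj)
    filter_upwards [ht.eventually hdec, hf.eventually hAb'] with z hz hz'
    rw [hz, hh]
    simp only
    rw [mul_add (z.1 ^ (k * d)), Finset.mul_sum]
    congr 1
    · refine Finset.sum_congr rfl fun j hj => ?_
      have hjd := Finset.mem_range.1 hj
      rw [hz' j hj, mul_pow, ← pow_mul]
      calc _ = z.1 ^ (k * (d - j) + k * j) * (b j z.1 * (c + z.2) ^ j) := by rw [pow_add]; ring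
        _ = _ := by rw [← mul_add, Nat.sub_add_cancel hjd.le]
    · rw [mul_pow, ← pow_mul, mul_assoc]

/-- A holomorphic function of finite positive order in `y` has a Puiseux root. -/
theorem AnalyticAt.exists_puiseux_root {d : ℕ} (hd : 0 < d) {g : ℂ × ℂ → ℂ}
    (hg : AnalyticAt ℂ g 0) (hord : analyticOrderAt (fun y => g (0, y)) 0 = d) :
    ∃ (n : ℕ) (ψ : ℂ → ℂ), 0 < n ∧ AnalyticAt ℂ ψ 0 ∧ ψ 0 = 0 ∧
      ∀ᶠ t in 𝓝 (0 : ℂ), g (t ^ n, ψ t) = 0 := by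
  induction d using Nat.strong_induction_on generalizing g with
  | _ d ih =>
  obtain ⟨τ, hτ, hτ0, hτd⟩ := hg.exists_tschirnhaus hd hord
  set g' : ℂ × ℂ → ℂ := fun z => g (z.1, z.2 + τ z.1) with hg'
  have hτ' : AnalyticAt ℂ (fun z : ℂ × ℂ => τ z.1) 0 := AnalyticAt.fun_comp (g := τ) hτ analyticAt_fst
  have hg'a : AnalyticAt ℂ g' 0 := by
    refine AnalyticAt.fun_comp (g := g) ?_ (analyticAt_fst.prod (analyticAt_snd.add hτ'))
    simp only [Prod.fst_zero, Prod.snd_zero, hτ0, add_zero]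
    exact hg
  by_cases h0 : ∀ᶠ x in 𝓝 (0 : ℂ), g' (x, 0) = 0
  -- After the translation `y = 0` is a root, hence `τ` is a root of `g`.
  · exact ⟨1, τ, one_pos, hτ, hτ0, by simpa [hg'] using h0⟩
  obtain ⟨m, k, e, c, h, hm, hk, he, hed, hh, hhord, hgh⟩ :=
    hg'a.exists_newton_step hd (by simpa [hg', hτ0] using hord) hτd h0
  obtain ⟨n, χ, hn, hχ, hχ0, hroot⟩ := ih e hed he hh hhord
  have hp : AnalyticAt ℂ (fun s : ℂ => (s ^ n) ^ m) 0 := (analyticAt_id.pow n).pow m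
  have hp0 : ((0 : ℂ) ^ n) ^ m = 0 := by rw [zero_pow hn.ne', zero_pow hm.ne']
  -- Undo the substitutions `x = t ^ m`, `y = t ^ k * (c + w) + τ x` at `t = s ^ n`, `w = χ s`.
  refine ⟨n * m, fun s => (s ^ n) ^ k * (c + χ s) + τ ((s ^ n) ^ m), Nat.mul_pos hn hm,
    (((analyticAt_id.pow n).pow k).mul (analyticAt_const.add hχ)).add
      (AnalyticAt.fun_comp (g := τ) (by rwa [hp0]) hp), ?_, ?_⟩
  · simp only
    rw [hp0, hτ0, zero_pow hn.ne', zero_pow hk.ne']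
    simp
  · have ht : Tendsto (fun s : ℂ => (s ^ n, χ s)) (𝓝 0) (𝓝 0) := by
      have hχt : Tendsto χ (𝓝 0) (𝓝 0) := by simpa only [hχ0] using hχ.continuousAt.tendsto
      refine (Continuous.tendsto' ?_ _ _ ?_).prodMk_nhds hχt
      · fun_prop
      · exact zero_pow hn.ne'
    filter_upwards [ht.eventually hgh, hroot] with s hs hs'
    simp only [hg'] at hs
    rw [pow_mul, hs, hs', mul_zero]

/-! ### The Puiseux factorization. -/

theorem AnalyticAt.exists_div_sub {g : ℂ × ℂ → ℂ} (hg : AnalyticAt ℂ g 0) {ψ : ℂ → ℂ}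
    (hψ : AnalyticAt ℂ ψ 0) (hψ0 : ψ 0 = 0) (h : ∀ᶠ t in 𝓝 (0 : ℂ), g (t, ψ t) = 0) :
    ∃ g₁ : ℂ × ℂ → ℂ, AnalyticAt ℂ g₁ 0 ∧
      ∀ᶠ z in 𝓝 (0 : ℂ × ℂ), g z = (z.2 - ψ z.1) * g₁ z := by
  have hψ' : AnalyticAt ℂ (fun z : ℂ × ℂ => ψ z.1) 0 :=
    AnalyticAt.fun_comp (g := ψ) (f := Prod.fst) (x := (0 : ℂ × ℂ)) hψ analyticAt_fst
  have hg' : AnalyticAt ℂ (fun z : ℂ × ℂ => g (z.1, z.2 + ψ z.1)) 0 := by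
    refine AnalyticAt.fun_comp (g := g) ?_ (analyticAt_fst.prod (analyticAt_snd.add hψ'))
    simp only [Prod.fst_zero, Prod.snd_zero, hψ0, add_zero]
    exact hg
  obtain ⟨g₂, hg₂, hdiv⟩ := hg'.exists_div_snd (by simpa using h)
  have ha : AnalyticAt ℂ (fun z : ℂ × ℂ => (z.1, z.2 - ψ z.1)) 0 :=
    analyticAt_fst.prod (analyticAt_snd.sub hψ')
  have ha0 : ((0 : ℂ × ℂ).1, (0 : ℂ × ℂ).2 - ψ (0 : ℂ × ℂ).1) = 0 := by simp [hψ0]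
  have ht := ha.continuousAt.tendsto
  rw [ha0] at ht
  refine ⟨fun z => g₂ (z.1, z.2 - ψ z.1), AnalyticAt.fun_comp (g := g₂) (by rwa [ha0]) ha, ?_⟩
  filter_upwards [ht.eventually hdiv] with z hz
  simpa using hz

theorem analyticAt_pow_fst {g : ℂ × ℂ → ℂ} (hg : AnalyticAt ℂ g 0) {n : ℕ} (hn : 0 < n) :
    AnalyticAt ℂ (fun z : ℂ × ℂ => g (z.1 ^ n, z.2)) 0 := by
  refine AnalyticAt.fun_comp (g := g) ?_ ((analyticAt_fst.pow n).prod analyticAt_snd)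
  simp only [Prod.fst_zero, Prod.snd_zero, zero_pow hn.ne']
  exact hg

theorem tendsto_pow_fst {n : ℕ} (hn : 0 < n) :
    Tendsto (fun z : ℂ × ℂ => (z.1 ^ n, z.2)) (𝓝 0) (𝓝 0) :=
  Continuous.tendsto' (by fun_prop) _ _ (by simp [hn.ne'])

/-- The Puiseux factorization of a holomorphic function of finite order in `y`. -/
theorem AnalyticAt.exists_puiseux_factorization {d : ℕ} {g : ℂ × ℂ → ℂ}
    (hg : AnalyticAt ℂ g 0) (hord : analyticOrderAt (fun y => g (0, y)) 0 = d) :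
    ∃ (n : ℕ) (ψ : Fin d → ℂ → ℂ) (u : ℂ × ℂ → ℂ), 0 < n ∧ (∀ ν, AnalyticAt ℂ (ψ ν) 0) ∧
      (∀ ν, ψ ν 0 = 0) ∧ AnalyticAt ℂ u 0 ∧ u 0 ≠ 0 ∧
      ∀ᶠ z in 𝓝 (0 : ℂ × ℂ), g (z.1 ^ n, z.2) = u z * ∏ ν, (z.2 - ψ ν z.1) := by
  induction d generalizing g with
  | zero =>
    have hg0 : AnalyticAt ℂ (fun y => g (0, y)) 0 :=
      AnalyticAt.comp₂ (h := g) hg analyticAt_const analyticAt_id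
    exact ⟨1, Fin.elim0, g, one_pos, fun ν => ν.elim0, fun ν => ν.elim0, hg,
      hg0.analyticOrderAt_eq_zero.1 (by simpa using hord), by simp⟩
  | succ d ih =>
    obtain ⟨n, ψ, hn, hψ, hψ0, hroot⟩ := hg.exists_puiseux_root d.succ_pos hord
    obtain ⟨g₁, hg₁, hdiv⟩ := (analyticAt_pow_fst hg hn).exists_div_sub hψ hψ0 hroot
    have hg₁0 : AnalyticAt ℂ (fun y => g₁ (0, y)) 0 :=
      AnalyticAt.comp₂ (h := g₁) hg₁ analyticAt_const analyticAt_id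
    have hord₁ : analyticOrderAt (fun y => g₁ (0, y)) 0 = d := by
      have h1 : (fun y => g (0, y)) =ᶠ[𝓝 0] (id : ℂ → ℂ) * fun y => g₁ (0, y) := by
        have ht : Tendsto (fun y : ℂ => ((0 : ℂ), y)) (𝓝 0) (𝓝 0) :=
          Continuous.tendsto' (by fun_prop) _ _ rfl
        filter_upwards [ht.eventually hdiv] with y hy
        simpa [hψ0, hn.ne'] using hy
      rw [analyticOrderAt_congr h1, analyticOrderAt_mul analyticAt_id hg₁0, analyticOrderAt_id,
        Nat.cast_succ, add_comm] at hord
      exact (ENat.add_left_injective_of_ne_top ENat.one_ne_top) hord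
    obtain ⟨n', ψ', u, hn', hψ', hψ'0, hu, hu0, hfac⟩ := ih hg₁ hord₁
    -- The remaining roots need a further ramification of order `n'`, so the first root is
    -- reparametrized accordingly.
    refine ⟨n' * n, Fin.cons (fun t => ψ (t ^ n')) ψ', u, Nat.mul_pos hn' hn,
      fun ν => ?_, fun ν => ?_, hu, hu0, ?_⟩
    · refine Fin.cases ?_ (fun ν => ?_) ν
      · simp only [Fin.cons_zero]
        refine AnalyticAt.fun_comp (g := ψ) ?_ (analyticAt_id.pow n')
        simpa [hn'.ne'] using hψ
      · simpa using hψ' ν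
    · refine Fin.cases ?_ (fun ν => ?_) ν
      · simpa [hn'.ne'] using hψ0
      · simpa using hψ'0 ν
    · filter_upwards [(tendsto_pow_fst hn').eventually hdiv, hfac] with z hz hz'
      rw [Fin.prod_univ_succ, pow_mul, hz, hz']
      simp only [Fin.cons_zero, Fin.cons_succ]
      ring

theorem exists_factorsComplex {f : ℂ × ℂ → ℂ} (hf : AnalyticAt ℂ f 0)
    (h0 : ¬ ∀ᶠ z in 𝓝 (0 : ℂ × ℂ), f z = 0) :
    ∃ D : NewtonPuiseux.PuiseuxData, D.FactorsComplex f := by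
  classical
  obtain ⟨α, g, hg, hg0, hfg⟩ := hf.exists_eq_fst_pow_mul h0
  obtain ⟨d, hd⟩ := ENat.ne_top_iff_exists.1 (mt analyticOrderAt_eq_top.1 hg0)
  obtain ⟨n, ψ, u, hn, hψ, hψ0, hu, hu0, hfac⟩ := hg.exists_puiseux_factorization hd.symm
  -- The roots that vanish identically make up the factor `y ^ β`.
  set Z : Finset (Fin d) := {ν | ∀ᶠ t in 𝓝 (0 : ℂ), ψ ν t = 0} with hZ
  have hmem : ∀ ν, ν ∈ Z ↔ ∀ᶠ t in 𝓝 (0 : ℂ), ψ ν t = 0 := fun ν => by simp [hZ]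
  let e := Zᶜ.equivFin
  refine ⟨{ α := α, β := Z.card, N := Zᶜ.card, n := n, n_pos := hn, u := u, u_analytic := hu,
            u_ne_zero := hu0, ψ := fun ν => ψ (e.symm ν), ψ_analytic := fun ν => hψ _,
            ψ_zero := fun ν => hψ0 _,
            ψ_ne_zero := fun ν h => Finset.mem_compl.1 (e.symm ν).2 ((hmem _).2 h) }, ?_⟩
  have hzero : ∀ᶠ t in 𝓝 (0 : ℂ), ∀ ν ∈ Z, ψ ν t = 0 :=
    (Finset.eventually_all _).2 fun ν hν => (hmem ν).1 hν
  have hfst : Tendsto Prod.fst (𝓝 (0 : ℂ × ℂ)) (𝓝 0) := continuous_fst.tendsto _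
  unfold NewtonPuiseux.PuiseuxData.FactorsComplex
  filter_upwards [(tendsto_pow_fst hn).eventually hfg, hfac, hfst.eventually hzero] with z h1 h2 h3
  rw [h1, h2, NewtonPuiseux.PuiseuxData.eval]
  simp only
  rw [e.symm.prod_comp (fun ν : (Zᶜ : Finset (Fin d)) => z.2 - ψ ν z.1),
    Finset.prod_coe_sort (Zᶜ) (fun ν => z.2 - ψ ν z.1), ← Finset.prod_mul_prod_compl Z,
    Finset.prod_congr rfl fun ν hν => by rw [h3 ν hν, sub_zero], Finset.prod_const]
  ring

/-! ### Leading terms and the separation of the roots. -/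

theorem AnalyticAt.exists_leading_term {ψ : ℂ → ℂ} (hψ : AnalyticAt ℂ ψ 0)
    (hne : ¬ ∀ᶠ t in 𝓝 (0 : ℂ), ψ t = 0) :
    ∃ (k : ℕ) (b : ℂ), b ≠ 0 ∧
      (fun t : ℂ => ψ t - b * t ^ k) =O[𝓝 0] fun t : ℂ => t ^ (k + 1) := by
  obtain ⟨k, u, hu, hu0, h⟩ := hψ.exists_eventuallyEq_pow_smul_nonzero_iff.2 hne
  refine ⟨k, u 0, hu0, ?_⟩
  have h1 : (fun t => u t - u 0) =O[𝓝 0] fun t : ℂ => t := by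
    simpa using hu.differentiableAt.isBigO_sub
  refine (((isBigO_refl (fun t : ℂ => t ^ k) (𝓝 0)).mul h1).congr' ?_ ?_)
  · filter_upwards [h] with t ht
    simp only [sub_zero, smul_eq_mul] at ht
    rw [ht]
    ring
  · exact Eventually.of_forall fun t => (pow_succ t k).symm

theorem isBigO_pow_of_leading_term {ψ : ℂ → ℂ} {k : ℕ} {b : ℂ} (hb : b ≠ 0)
    (h : (fun t : ℂ => ψ t - b * t ^ k) =o[𝓝 0] fun t : ℂ => t ^ k) :
    (fun t : ℂ => t ^ k) =O[𝓝 0] ψ := by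
  have h1 : IsEquivalent (𝓝 0) ψ fun t : ℂ => b * t ^ k :=
    h.trans_isBigO (isBigO_self_const_mul hb _ _)
  exact (isBigO_self_const_mul hb _ _).trans h1.isTheta.2

theorem isLittleO_pow_succ (k : ℕ) : (fun t : ℂ => t ^ (k + 1)) =o[𝓝 0] fun t : ℂ => t ^ k :=
  isLittleO_pow_pow k.lt_succ_self

/-- Roots with distinct leading terms are separated. -/
theorem isBigO_pow_sub_of_leading_terms {ψ ψ' : ℂ → ℂ} {k k' : ℕ} {b b' : ℂ} (hb : b ≠ 0)
    (h : (fun t : ℂ => ψ t - b * t ^ k) =O[𝓝 0] fun t : ℂ => t ^ (k + 1))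
    (h' : (fun t : ℂ => ψ' t - b' * t ^ k') =O[𝓝 0] fun t : ℂ => t ^ (k' + 1))
    (hkk : k ≤ k') (hne : k = k' → b ≠ b') :
    (fun t : ℂ => t ^ k) =O[𝓝 0] fun t => ψ t - ψ' t := by
  have h1 := h.trans_isLittleO (isLittleO_pow_succ k)
  have h2 := h'.trans_isLittleO (isLittleO_pow_succ k')
  rcases hkk.eq_or_lt with rfl | hlt
  · refine isBigO_pow_of_leading_term (sub_ne_zero.2 (hne rfl)) ?_
    refine (h1.sub h2).congr_left fun t => ?_
    ring
  · refine isBigO_pow_of_leading_term hb ?_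
    have h3 : (fun t : ℂ => t ^ k') =o[𝓝 0] fun t : ℂ => t ^ k := isLittleO_pow_pow hlt
    refine ((h1.sub (h2.trans h3)).sub (h3.const_mul_left b')).congr_left fun t => ?_
    ring

theorem Asymptotics.IsBigO.eventually_mul_norm_le {f g : ℂ → ℂ} (h : f =O[𝓝 0] g) :
    ∀ᶠ ε : ℝ in 𝓝[>] 0, ∀ᶠ t in 𝓝 (0 : ℂ), ε * ‖f t‖ ≤ ‖g t‖ := by
  obtain ⟨c, hc, h⟩ := h.exists_pos
  filter_upwards [Ioo_mem_nhdsGT (inv_pos.2 hc)] with ε hε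
  filter_upwards [h.bound] with t ht
  calc ε * ‖f t‖ ≤ c⁻¹ * (c * ‖g t‖) := by
        gcongr
        exact hε.2.le
    _ = ‖g t‖ := by field_simp

/-- The leading exponents and coefficients of the roots of a Puiseux factorization. -/
structure LeadingTerms (D : NewtonPuiseux.PuiseuxData) (k : Fin D.N → ℕ) (b : Fin D.N → ℂ) :
    Prop where
  ne_zero : ∀ ν, b ν ≠ 0
  isBigO : ∀ ν, (fun t : ℂ => D.ψ ν t - b ν * t ^ k ν) =O[𝓝 0] fun t : ℂ => t ^ (k ν + 1)

theorem exists_leadingTerms (D : NewtonPuiseux.PuiseuxData) : ∃ k b, LeadingTerms D k b := by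
  choose k b hb h using fun ν => (D.ψ_analytic ν).exists_leading_term (D.ψ_ne_zero ν)
  exact ⟨k, b, hb, h⟩

namespace LeadingTerms

variable {D : NewtonPuiseux.PuiseuxData} {k : Fin D.N → ℕ} {b : Fin D.N → ℂ}

theorem card_le_mult (h : LeadingTerms D k b) (μ : Fin D.N) (S : Finset (Fin D.N))
    (hS : ∀ ν ∈ S, k ν = k μ ∧ b ν = b μ) : S.card ≤ D.mult ((k μ : ℚ) / D.n) (b μ) := by
  rw [← Set.ncard_coe_finset, NewtonPuiseux.PuiseuxData.mult]
  refine Set.ncard_le_ncard (fun ν hν => ?_) (Set.toFinite _)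
  obtain ⟨h1, h2⟩ := hS ν hν
  have hn : (D.n : ℚ) ≠ 0 := by exact_mod_cast D.n_pos.ne'
  refine ⟨h.ne_zero μ, k μ, by field_simp, ?_⟩
  rw [← h1, ← h2]
  exact h.isBigO ν

/-- The estimates for the roots in terms of their leading exponents. -/
theorem exists_separation (h : LeadingTerms D k b) :
    ∃ ε : ℝ, 0 < ε ∧ ε ≤ 1 ∧ ∀ᶠ t in 𝓝 (0 : ℂ),
      (∀ ν, ε * ‖t‖ ^ k ν ≤ ‖D.ψ ν t‖ ∧ ε * ‖D.ψ ν t‖ ≤ ‖t‖ ^ k ν) ∧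
      ∀ ν μ, ¬ (k ν = k μ ∧ b ν = b μ) →
        ε * ‖t‖ ^ k ν ≤ ‖D.ψ ν t - D.ψ μ t‖ ∧ ε * ‖t‖ ^ k μ ≤ ‖D.ψ ν t - D.ψ μ t‖ := by
  have hlo : ∀ ν, (fun t : ℂ => t ^ k ν) =O[𝓝 0] D.ψ ν := fun ν =>
    isBigO_pow_of_leading_term (h.ne_zero ν) ((h.isBigO ν).trans_isLittleO (isLittleO_pow_succ _))
  have hhi : ∀ ν, D.ψ ν =O[𝓝 0] (fun t : ℂ => t ^ k ν) := fun ν => by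
    have h1 := (h.isBigO ν).trans (isLittleO_pow_succ (k ν)).isBigO
    refine (h1.add (isBigO_const_mul_self (b ν) (fun t : ℂ => t ^ k ν) (𝓝 0))).congr_left
      fun t => by ring
  have hsep : ∀ ν μ, ¬ (k ν = k μ ∧ b ν = b μ) →
      (fun t : ℂ => t ^ k ν) =O[𝓝 0] fun t => D.ψ ν t - D.ψ μ t := by
    intro ν μ hne
    rcases le_total (k ν) (k μ) with hle | hle
    · exact isBigO_pow_sub_of_leading_terms (h.ne_zero ν) (h.isBigO ν) (h.isBigO μ) hle
        fun h1 h2 => hne ⟨h1, h2⟩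
    · have h1 := isBigO_pow_sub_of_leading_terms (h.ne_zero μ) (h.isBigO μ) (h.isBigO ν) hle
        fun h1 h2 => hne ⟨h1.symm, h2.symm⟩
      have h2 : (fun t : ℂ => t ^ k ν) =O[𝓝 0] fun t : ℂ => t ^ k μ := by
        rcases hle.eq_or_lt with he | hlt
        · rw [he]
        · exact (isLittleO_pow_pow hlt).isBigO
      exact (h2.trans h1).trans (isBigO_of_le _ fun t => (norm_sub_rev _ _).le)
  have e1 := eventually_all.2 fun ν => (hlo ν).eventually_mul_norm_le
  have e2 := eventually_all.2 fun ν => (hhi ν).eventually_mul_norm_le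
  have e3 : ∀ᶠ ε : ℝ in 𝓝[>] 0, ∀ ν μ, ¬ (k ν = k μ ∧ b ν = b μ) →
      ∀ᶠ t in 𝓝 (0 : ℂ), ε * ‖t ^ k ν‖ ≤ ‖D.ψ ν t - D.ψ μ t‖ :=
    eventually_all.2 fun ν => eventually_all.2 fun μ => by
      by_cases hne : k ν = k μ ∧ b ν = b μ
      · simp [hne]
      · filter_upwards [(hsep ν μ hne).eventually_mul_norm_le] with ε hε _ using hε
  obtain ⟨ε, h1, h2, h3, h4⟩ :=
    (e1.and (e2.and (e3.and (Ioo_mem_nhdsGT (zero_lt_one (α := ℝ)))))).exists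
  refine ⟨ε, h4.1, h4.2.le, ?_⟩
  have h3' : ∀ᶠ t in 𝓝 (0 : ℂ), ∀ ν μ, ¬ (k ν = k μ ∧ b ν = b μ) →
      ε * ‖t ^ k ν‖ ≤ ‖D.ψ ν t - D.ψ μ t‖ :=
    eventually_all.2 fun ν => eventually_all.2 fun μ => by
      by_cases hne : k ν = k μ ∧ b ν = b μ
      · simp [hne]
      · filter_upwards [h3 ν μ hne] with t ht _ using ht
  filter_upwards [eventually_all.2 h1, eventually_all.2 h2, h3'] with t ht1 ht2 ht3
  simp only [norm_pow] at ht1 ht2 ht3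
  refine ⟨fun ν => ⟨ht1 ν, ht2 ν⟩, fun ν μ hne => ⟨ht3 ν μ hne, ?_⟩⟩
  rw [norm_sub_rev]
  exact ht3 μ ν fun h => hne ⟨h.1.symm, h.2.symm⟩

/-- If at most `T` roots share a leading term, then the distances of `y` to the roots are bounded
below by their generic sizes, up to the factor `(z / ‖y‖) ^ T` for the least distance `z`. -/
theorem exists_prod_lower_bound (h : LeadingTerms D k b) {T : ℝ} (hT : 0 < T)
    (hm : ∀ a b, (D.mult a b : ℝ) ≤ T) :
    ∃ c : ℝ, 0 < c ∧ ∀ᶠ t in 𝓝 (0 : ℂ), t ≠ 0 → ∀ (y : ℂ) (z : ℝ), 0 ≤ z → z ≤ ‖y‖ →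
      (∀ ν, z ≤ ‖y - D.ψ ν t‖) →
      c * (z ^ T * ∏ ν, (‖y‖ + ‖t‖ ^ k ν)) ≤ ‖y‖ ^ T * ∏ ν, ‖y - D.ψ ν t‖ := by
  classical
  obtain ⟨ε, hε0, hε1, hsep⟩ := h.exists_separation
  -- Chosen for `hfar`: there `ε ^ 2 * ‖y‖` contributes at most `‖y - ψ‖ + ε * ‖t‖ ^ k` and `ε ^ 2 *
  -- ‖t‖ ^ k` at most `ε * ‖t‖ ^ k`, where `ε * ‖t‖ ^ k ≤ 2 * ‖y - ψ‖`; hence `1 + 2 + 2`.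
  set L : ℝ := 5 / ε ^ 2 with hL
  have hL0 : 0 < L := by positivity
  refine ⟨(L ^ D.N)⁻¹ * (ε / 2) ^ T, by positivity, ?_⟩
  have hε2 : (ε / 2) ^ T ≤ 1 := Real.rpow_le_one (by positivity) (by linarith) hT.le
  filter_upwards [hsep] with t ht ht0 y z hz0 hzy hz
  obtain ⟨hlh, hsep⟩ := ht
  have hτ : ∀ ν, 0 < ‖t‖ ^ k ν := fun ν => pow_pos (norm_pos_iff.2 ht0) _
  have hLε : L * ε ^ 2 = 5 := by rw [hL]; field_simp
  have hfar : ∀ ν, ε / 2 * ‖t‖ ^ k ν ≤ ‖y - D.ψ ν t‖ →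
      ‖y‖ + ‖t‖ ^ k ν ≤ L * ‖y - D.ψ ν t‖ := by
    intro ν hν
    have h1 : ‖y‖ ≤ ‖y - D.ψ ν t‖ + ‖D.ψ ν t‖ := by
      simpa using norm_add_le (y - D.ψ ν t) (D.ψ ν t)
    have h2 := (hlh ν).2
    have h3 := hτ ν
    have h4 : ε ^ 2 * (‖y‖ + ‖t‖ ^ k ν) ≤ ε ^ 2 * (L * ‖y - D.ψ ν t‖) := by
      rw [← mul_assoc, mul_comm (ε ^ 2) L, hLε]
      have h5 : ε ^ 2 * ‖y - D.ψ ν t‖ ≤ 1 * ‖y - D.ψ ν t‖ := by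
        gcongr
        nlinarith
      have h6 : ε * (ε * ‖D.ψ ν t‖) ≤ ε * ‖t‖ ^ k ν := by gcongr
      have h7 : ε ^ 2 * ‖t‖ ^ k ν ≤ ε * ‖t‖ ^ k ν := by
        gcongr
        nlinarith
      nlinarith [norm_nonneg (y - D.ψ ν t)]
    exact le_of_mul_le_mul_left h4 (by positivity)
  set S : Finset (Fin D.N) := {ν | ‖y - D.ψ ν t‖ < ε / 2 * ‖t‖ ^ k ν} with hS
  have hmem : ∀ ν, ν ∈ S ↔ ‖y - D.ψ ν t‖ < ε / 2 * ‖t‖ ^ k ν := fun ν => by simp [hS]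
  have hconst : ∏ ν : Fin D.N, L * ‖y - D.ψ ν t‖ = L ^ D.N * ∏ ν, ‖y - D.ψ ν t‖ := by
    rw [Finset.prod_mul_distrib]
    simp
  rw [mul_assoc, inv_mul_le_iff₀ (by positivity), mul_left_comm (L ^ D.N), ← hconst]
  rcases S.eq_empty_or_nonempty with hSe | ⟨μ, hμ⟩
  · have h1 : ∏ ν, (‖y‖ + ‖t‖ ^ k ν) ≤ ∏ ν, L * ‖y - D.ψ ν t‖ := by
      refine Finset.prod_le_prod (fun ν _ => by positivity) fun ν _ => hfar ν ?_
      have : ν ∉ S := by simp [hSe]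
      rw [hmem] at this
      exact not_lt.1 this
    calc (ε / 2) ^ T * (z ^ T * ∏ ν, (‖y‖ + ‖t‖ ^ k ν))
        ≤ 1 * (‖y‖ ^ T * ∏ ν, L * ‖y - D.ψ ν t‖) := by gcongr
      _ = _ := one_mul _
  -- Two roots close to the same `y` lie nearer to each other than roots with different leading
  -- terms can.
  · have hcl : ∀ ν ∈ S, k ν = k μ ∧ b ν = b μ := by
      intro ν hν
      by_contra hne
      obtain ⟨h1, h2⟩ := hsep ν μ hne
      have h3 := (hmem ν).1 hν
      have h4 := (hmem μ).1 hμ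
      have h5 : ‖D.ψ ν t - D.ψ μ t‖ ≤ ‖y - D.ψ ν t‖ + ‖y - D.ψ μ t‖ := by
        rw [norm_sub_rev y (D.ψ ν t)]
        simpa using norm_add_le (D.ψ ν t - y) (y - D.ψ μ t)
      linarith
    have hcard : (S.card : ℝ) ≤ T := le_trans (by exact_mod_cast h.card_le_mult μ S hcl) (hm _ _)
    set τ := ‖t‖ ^ k μ with hτdef
    have hτ0 : 0 < τ := hτ μ
    have hμ' := (hmem μ).1 hμ
    have hzτ : z ≤ τ := (hz μ).trans (hμ'.le.trans (by nlinarith))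
    have hzτ1 : z / τ ≤ 1 := div_le_one_of_le₀ hzτ hτ0.le
    have hq0 : 0 ≤ z / τ := by positivity
    have hyτ : ε / 2 * τ ≤ ‖y‖ := by
      have h1 : ‖D.ψ μ t‖ ≤ ‖y‖ + ‖y - D.ψ μ t‖ := by
        rw [norm_sub_rev]
        simpa using norm_add_le y (D.ψ μ t - y)
      have h2 := (hlh μ).1
      linarith
    have hnear : ∀ ν ∈ S, z / τ * (‖y‖ + ‖t‖ ^ k ν) ≤ L * ‖y - D.ψ ν t‖ := by
      intro ν hν
      have hk := (hcl ν hν).1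
      rw [hk, ← hτdef]
      have h1 : ‖y‖ ≤ ‖y - D.ψ μ t‖ + ‖D.ψ μ t‖ := by
        simpa using norm_add_le (y - D.ψ μ t) (D.ψ μ t)
      have h2 := (hlh μ).2
      have h3 : ‖y‖ + τ ≤ L * τ := by
        have h4 : ε ^ 2 * (‖y‖ + τ) ≤ ε ^ 2 * (L * τ) := by
          rw [← mul_assoc, mul_comm (ε ^ 2) L, hLε]
          have h5 : ε ^ 2 ≤ 1 := by nlinarith
          have h6 : ε * (ε * ‖D.ψ μ t‖) ≤ ε * τ := by gcongr
          have h7 : ε ^ 2 * ‖y - D.ψ μ t‖ ≤ 1 * (ε / 2 * τ) := by gcongr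
          nlinarith
        exact le_of_mul_le_mul_left h4 (by positivity)
      calc z / τ * (‖y‖ + τ) ≤ z / τ * (L * τ) := by gcongr
        _ = L * z := by field_simp
        _ ≤ L * ‖y - D.ψ ν t‖ := by gcongr; exact hz ν
    have hprod : (z / τ) ^ S.card * ∏ ν, (‖y‖ + ‖t‖ ^ k ν) ≤ ∏ ν, L * ‖y - D.ψ ν t‖ := by
      rw [← Finset.prod_mul_prod_compl S, ← Finset.prod_mul_prod_compl S, ← mul_assoc,
        ← Finset.prod_const, ← Finset.prod_mul_distrib]
      refine mul_le_mul (Finset.prod_le_prod (fun ν _ => by positivity) hnear)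
        (Finset.prod_le_prod (fun ν _ => by positivity) fun ν hν => hfar ν ?_)
        (Finset.prod_nonneg fun ν _ => by positivity) (Finset.prod_nonneg fun ν _ => by positivity)
      rw [Finset.mem_compl, hmem] at hν
      exact not_lt.1 hν
    -- The multiplicity hypothesis is spent here: each close root costs a factor `z / τ ≤ 1`, there
    -- are at most `T` of them, and `τ` is at most a constant times `‖y‖`.
    have hzT : (ε / 2) ^ T * z ^ T ≤ ‖y‖ ^ T * (z / τ) ^ S.card := by
      rcases hz0.eq_or_lt with hz00 | hzpos
      · rw [← hz00, Real.zero_rpow hT.ne', mul_zero]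
        positivity
      have hq : (z / τ) ^ T ≤ (z / τ) ^ S.card := by
        rw [← Real.rpow_natCast]
        exact Real.rpow_le_rpow_of_exponent_ge (by positivity) hzτ1 hcard
      calc (ε / 2) ^ T * z ^ T = (ε / 2 * τ) ^ T * (z / τ) ^ T := by
            rw [← Real.mul_rpow (by positivity) hz0, ← Real.mul_rpow (by positivity) hq0]
            congr 1
            field_simp
        _ ≤ _ := by gcongr
    calc (ε / 2) ^ T * (z ^ T * ∏ ν, (‖y‖ + ‖t‖ ^ k ν))
        = ((ε / 2) ^ T * z ^ T) * ∏ ν, (‖y‖ + ‖t‖ ^ k ν) := by ring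
      _ ≤ (‖y‖ ^ T * (z / τ) ^ S.card) * ∏ ν, (‖y‖ + ‖t‖ ^ k ν) := by gcongr
      _ = ‖y‖ ^ T * ((z / τ) ^ S.card * ∏ ν, (‖y‖ + ‖t‖ ^ k ν)) := by ring
      _ ≤ _ := by gcongr

end LeadingTerms

/-! ### Cauchy estimates: the generic size dominates the Newton polyhedron. -/

/-- The Cauchy estimate for the Taylor coefficients of a function on a bidisc. -/
theorem HasDoubleSeries.norm_coeff_mul_le {F : ℂ × ℂ → ℂ} {a : ℕ × ℕ → ℂ} {r : ℝ}
    (h : HasDoubleSeries F a r) (hF : ∀ z ∈ Metric.ball (0 : ℂ × ℂ) r, AnalyticAt ℂ F z)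
    {ρ σ M : ℝ} (hρ : 0 < ρ) (hρr : ρ < r) (hσ : 0 < σ) (hσr : σ < r)
    (hM : ∀ x y : ℂ, ‖x‖ = ρ → ‖y‖ = σ → ‖F (x, y)‖ ≤ M) (p q : ℕ) :
    ‖a (p, q)‖ * (ρ ^ p * σ ^ q) ≤ M := by
  have hfac : ∀ j : ℕ, (0 : ℝ) < j.factorial := fun j => by exact_mod_cast j.factorial_pos
  have hcol : ∀ x : ℂ, ‖x‖ = ρ → ‖columnSum a q x‖ ≤ M / σ ^ q := by
    intro x hx
    have hxr : ‖x‖ < r := hx.trans_lt hρr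
    have hd : DifferentiableOn ℂ (fun y => F (x, y)) (Metric.ball 0 r) := fun y hy => by
      have h1 : AnalyticAt ℂ F (x, y) := hF _ (by
        rw [mem_ball_zero_iff, Prod.norm_def]
        exact max_lt hxr (by simpa using hy))
      have h2 : AnalyticAt ℂ (fun y => F (x, y)) y :=
        h1.comp₂ analyticAt_const analyticAt_id
      exact h2.differentiableAt.differentiableWithinAt
    have h1 := Complex.norm_iteratedDeriv_le_of_forall_mem_sphere_norm_le (c := 0) (R := σ) q hσ
      (f := fun y => F (x, y)) (C := M) (hd.diffContOnCl_ball (Metric.closedBall_subset_ball hσr))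
      fun y hy => hM x y hx (by simpa using hy)
    rw [h.iteratedDeriv_right q hxr, norm_mul, Complex.norm_natCast, mul_div_assoc] at h1
    exact le_of_mul_le_mul_left h1 (hfac q)
  have h1 := Complex.norm_iteratedDeriv_le_of_forall_mem_sphere_norm_le (c := 0) (R := ρ) p hρ
    (f := columnSum a q) (C := M / σ ^ q)
    ((h.columnSum_differentiableOn q).diffContOnCl_ball (Metric.closedBall_subset_ball hρr))
    fun x hx => hcol x (by simpa using hx)
  rw [h.iteratedDeriv_columnSum, norm_mul, Complex.norm_natCast, mul_div_assoc] at h1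
  have h2 := le_of_mul_le_mul_left h1 (hfac p)
  rw [div_div, le_div_iff₀ (by positivity)] at h2
  rwa [mul_comm (ρ ^ p)]

theorem HasDoubleSeries.mono {𝕜 : Type*} [NontriviallyNormedField 𝕜] {f : 𝕜 × 𝕜 → 𝕜}
    {a : ℕ × ℕ → 𝕜} {r r' : ℝ} (h : HasDoubleSeries f a r) (hr' : 0 < r') (hle : r' ≤ r) :
    HasDoubleSeries f a r' :=
  ⟨hr', Summable.of_nonneg_of_le (fun _ => by positivity) (fun _ => by gcongr) h.summable,
    fun x y hx hy => h.hasSum x y (hx.trans_le hle) (hy.trans_le hle)⟩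

namespace NewtonPuiseux.PuiseuxData

/-- The size of a Puiseux factorization at points `(t, y)` with `‖t‖ = ρ` and `‖y‖ = σ` in general
position, for roots with leading exponents `k`. -/
def genericSize (D : PuiseuxData) (k : Fin D.N → ℕ) (ρ σ : ℝ) : ℝ :=
  (ρ ^ D.n) ^ D.α * σ ^ D.β * ∏ ν, (σ + ρ ^ k ν)

theorem genericSize_nonneg (D : PuiseuxData) (k : Fin D.N → ℕ) {ρ σ : ℝ} (hρ : 0 ≤ ρ)
    (hσ : 0 ≤ σ) : 0 ≤ D.genericSize k ρ σ := by
  unfold genericSize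
  exact mul_nonneg (by positivity) (Finset.prod_nonneg fun ν _ => by positivity)

end NewtonPuiseux.PuiseuxData

theorem exists_ball_of_eventually {P : ℂ × ℂ → Prop} (h : ∀ᶠ z in 𝓝 0, P z) :
    ∃ r : ℝ, 0 < r ∧ ∀ x y : ℂ, ‖x‖ < r → ‖y‖ < r → P (x, y) := by
  obtain ⟨r, hr, h⟩ := Metric.eventually_nhds_iff_ball.1 h
  refine ⟨r, hr, fun x y hx hy => h _ ?_⟩
  rw [mem_ball_zero_iff, Prod.norm_def]
  exact max_lt hx hy

namespace LeadingTerms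

variable {D : NewtonPuiseux.PuiseuxData} {k : Fin D.N → ℕ} {b : Fin D.N → ℂ} {F : ℂ × ℂ → ℂ}

theorem exists_norm_le_genericSize (h : LeadingTerms D k b) (hF : D.FactorsComplex F) :
    ∃ C : ℝ, 0 < C ∧ ∀ᶠ z in 𝓝 (0 : ℂ × ℂ),
      ‖F (z.1 ^ D.n, z.2)‖ ≤ C * D.genericSize k ‖z.1‖ ‖z.2‖ := by
  obtain ⟨ε, hε0, hε1, hsep⟩ := h.exists_separation
  have hfst : Tendsto Prod.fst (𝓝 (0 : ℂ × ℂ)) (𝓝 0) := continuous_fst.tendsto _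
  have hu : ∀ᶠ z in 𝓝 (0 : ℂ × ℂ), ‖D.u z‖ < ‖D.u 0‖ + 1 :=
    D.u_analytic.continuousAt.norm.eventually_lt continuousAt_const (by simp)
  refine ⟨(‖D.u 0‖ + 1) * (ε⁻¹) ^ D.N, by positivity, ?_⟩
  filter_upwards [hF, hfst.eventually hsep, hu] with z hz hs hu
  have h1 : ∀ ν, ‖z.2 - D.ψ ν z.1‖ ≤ ε⁻¹ * (‖z.2‖ + ‖z.1‖ ^ k ν) := fun ν => by
    have h2 := (hs.1 ν).2
    have h3 := norm_sub_le z.2 (D.ψ ν z.1)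
    rw [le_inv_mul_iff₀ hε0]
    nlinarith [norm_nonneg z.2]
  have h2 : ∏ ν, ‖z.2 - D.ψ ν z.1‖ ≤ (ε⁻¹) ^ D.N * ∏ ν, (‖z.2‖ + ‖z.1‖ ^ k ν) := by
    refine (Finset.prod_le_prod (fun ν _ => norm_nonneg _) fun ν _ => h1 ν).trans_eq ?_
    rw [Finset.prod_mul_distrib]
    simp
  rw [hz, NewtonPuiseux.PuiseuxData.eval, NewtonPuiseux.PuiseuxData.genericSize]
  simp only [norm_mul, norm_pow, norm_prod]
  calc _ ≤ (‖D.u 0‖ + 1) * ((‖z.1‖ ^ D.n) ^ D.α * ‖z.2‖ ^ D.β *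
        ((ε⁻¹) ^ D.N * ∏ ν, (‖z.2‖ + ‖z.1‖ ^ k ν))) := by gcongr
    _ = _ := by ring

/-- The generic size is constant on tori, so it can serve as the bound in the Cauchy estimate. The
radius `r` does not depend on the monomial, only `C` does; this allows convex combinations later. -/
theorem exists_monomial_le_genericSize (h : LeadingTerms D k b) (hF : D.FactorsComplex F)
    (hFa : AnalyticAt ℂ F 0) :
    ∃ r : ℝ, 0 < r ∧ r ≤ 1 ∧ ∀ p q : ℕ, NewtonPuiseux.taylorCoeff F p q ≠ 0 →
      ∃ C : ℝ, ∀ ρ σ : ℝ, 0 < ρ → ρ < r → 0 < σ → σ < r →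
        (ρ ^ D.n) ^ p * σ ^ q ≤ C * D.genericSize k ρ σ := by
  obtain ⟨C, hC, hup⟩ := h.exists_norm_le_genericSize hF
  obtain ⟨r₁, hr₁, hup⟩ := exists_ball_of_eventually hup
  obtain ⟨r₂, hr₂, han⟩ := exists_ball_of_eventually hFa.eventually_analyticAt
  obtain ⟨a, r₃, hser⟩ := hFa.exists_hasDoubleSeries
  set R := min r₂ r₃ with hR
  have hR0 : 0 < R := lt_min hr₂ hser.r_pos
  have hser' := hser.mono hR0 (min_le_right _ _)
  refine ⟨min r₁ (min R 1), lt_min hr₁ (lt_min hR0 one_pos),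
    (min_le_right _ _).trans (min_le_right _ _), fun p q hpq => ?_⟩
  rw [hser.taylorCoeff_eq] at hpq
  have ha : 0 < ‖a (p, q)‖ := norm_pos_iff.2 hpq
  refine ⟨‖a (p, q)‖⁻¹ * C, fun ρ σ hρ hρr hσ hσr => ?_⟩
  rw [lt_min_iff, lt_min_iff] at hρr hσr
  have hρn : ρ ^ D.n < R :=
    (pow_le_of_le_one hρ.le hρr.2.2.le D.n_pos.ne').trans_lt hρr.2.1
  have h1 := hser'.norm_coeff_mul_le (fun z hz => by
      rw [mem_ball_zero_iff, Prod.norm_def, max_lt_iff] at hz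
      exact han z.1 z.2 (hz.1.trans_le (min_le_left _ _)) (hz.2.trans_le (min_le_left _ _)))
    (pow_pos hρ D.n) hρn hσ hσr.2.1 (M := C * D.genericSize k ρ σ) (fun x y hx hy => by
      -- Every point of the circle `‖x‖ = ρ ^ n` is `t ^ n` with `‖t‖ = ρ`, so the bound in the
      -- variable `t` covers the whole torus.
      obtain ⟨t, rfl⟩ := IsAlgClosed.exists_pow_nat_eq x D.n_pos
      have ht : ‖t‖ = ρ := by
        rw [norm_pow] at hx
        exact (pow_left_inj₀ (norm_nonneg t) hρ.le D.n_pos.ne').1 hx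
      have h2 := hup t y (ht.trans_lt hρr.1) (hy.trans_lt hσr.1)
      simpa only [ht, hy] using h2) p q
  rw [mul_assoc, le_inv_mul_iff₀ ha]
  exact h1

theorem exists_rpow_le_genericSize (h : LeadingTerms D k b) (hF : D.FactorsComplex F)
    (hFa : AnalyticAt ℂ F 0) :
    ∃ r : ℝ, 0 < r ∧ ∀ w ∈ NewtonPuiseux.newtonPolyhedron F,
      ∃ C : ℝ, ∀ ρ σ : ℝ, 0 < ρ → ρ < r → 0 < σ → σ < r →
        (ρ ^ D.n) ^ w.1 * σ ^ w.2 ≤ C * D.genericSize k ρ σ := by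
  obtain ⟨r, hr, hr1, hmon⟩ := h.exists_monomial_le_genericSize hF hFa
  refine ⟨r, hr, fun w hw => ?_⟩
  refine convexHull_min (t := {w : ℝ × ℝ | ∃ C : ℝ, ∀ ρ σ : ℝ, 0 < ρ → ρ < r → 0 < σ → σ < r →
        (ρ ^ D.n) ^ w.1 * σ ^ w.2 ≤ C * D.genericSize k ρ σ}) ?_ ?_ hw
  · rintro w ⟨p, q, hpq, hp, hq⟩
    obtain ⟨C, hC⟩ := hmon p q hpq
    refine ⟨C, fun ρ σ hρ hρr hσ hσr => le_trans ?_ (hC ρ σ hρ hρr hσ hσr)⟩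
    rw [← Real.rpow_natCast _ p, ← Real.rpow_natCast _ q]
    have hρn : ρ ^ D.n ≤ 1 := pow_le_one₀ hρ.le (hρr.le.trans hr1)
    exact mul_le_mul (Real.rpow_le_rpow_of_exponent_ge (pow_pos hρ _) hρn hp)
      (Real.rpow_le_rpow_of_exponent_ge hσ (hσr.le.trans hr1) hq) (by positivity) (by positivity)
  · rintro w ⟨C, hC⟩ w' ⟨C', hC'⟩ s s' hs hs' hss
    refine ⟨s * C + s' * C', fun ρ σ hρ hρr hσ hσr => ?_⟩
    have hρn : 0 < ρ ^ D.n := pow_pos hρ _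
    have h1 : (ρ ^ D.n) ^ (s • w + s' • w').1 * σ ^ (s • w + s' • w').2 =
        ((ρ ^ D.n) ^ w.1 * σ ^ w.2) ^ s * ((ρ ^ D.n) ^ w'.1 * σ ^ w'.2) ^ s' := by
      simp only [Prod.fst_add, Prod.smul_fst, Prod.snd_add, Prod.smul_snd, smul_eq_mul]
      rw [Real.rpow_add hρn, Real.rpow_add hσ, Real.mul_rpow (by positivity) (by positivity),
        Real.mul_rpow (by positivity) (by positivity), ← Real.rpow_mul hρn.le,
        ← Real.rpow_mul hρn.le, ← Real.rpow_mul hσ.le, ← Real.rpow_mul hσ.le, mul_comm s,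
        mul_comm s', mul_comm s, mul_comm s']
      ring
    rw [h1]
    refine (Real.geom_mean_le_arith_mean2_weighted hs hs' (by positivity) (by positivity)
      hss).trans ?_
    have h2 := mul_le_mul_of_nonneg_left (hC ρ σ hρ hρr hσ hσr) hs
    have h3 := mul_le_mul_of_nonneg_left (hC' ρ σ hρ hρr hσ hσr) hs'
    linarith

end LeadingTerms

/-! ### The lower bound for the function. -/

/-- The lower bound for a holomorphic function in terms of the distance `z` of `y` to `0` and to
the Puiseux roots, for a point `(T, T)` of the Newton polyhedron such that no more than `T` roots
share a leading term. -/
theorem NewtonPuiseux.PuiseuxData.exists_lower_bound {D : NewtonPuiseux.PuiseuxData}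
    {F : ℂ × ℂ → ℂ} (hF : D.FactorsComplex F) (hFa : AnalyticAt ℂ F 0) {T : ℝ} (hT : 0 < T)
    (hm : ∀ a b, (D.mult a b : ℝ) ≤ T) (hNP : (T, T) ∈ NewtonPuiseux.newtonPolyhedron F) :
    ∃ c r : ℝ, 0 < c ∧ 0 < r ∧ ∀ t y : ℂ, t ≠ 0 → ‖t‖ < r → ‖y‖ < r → ∀ z : ℝ, 0 ≤ z → z ≤ ‖y‖ →
      (∀ ν, z ≤ ‖y - D.ψ ν t‖) → c * (‖t ^ D.n‖ ^ T * z ^ T) ≤ ‖F (t ^ D.n, y)‖ := by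
  obtain ⟨k, b, h⟩ := exists_leadingTerms D
  obtain ⟨c₁, hc₁, hprod⟩ := h.exists_prod_lower_bound hT hm
  obtain ⟨r₁, hr₁, hgen⟩ := h.exists_rpow_le_genericSize hF hFa
  obtain ⟨C, hC⟩ := hgen _ hNP
  have hfst : Tendsto Prod.fst (𝓝 (0 : ℂ × ℂ)) (𝓝 0) := continuous_fst.tendsto _
  have hu0 : 0 < ‖D.u 0‖ := norm_pos_iff.2 D.u_ne_zero
  have hu : ∀ᶠ z in 𝓝 (0 : ℂ × ℂ), ‖D.u 0‖ / 2 < ‖D.u z‖ :=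
    continuousAt_const.eventually_lt D.u_analytic.continuousAt.norm (by simpa using hu0)
  obtain ⟨r₂, hr₂, hloc⟩ := exists_ball_of_eventually
    ((hfst.eventually hprod).and (hu.and hF))
  set C' := max C 1 with hC'
  have hC'0 : 0 < C' := lt_max_of_lt_right one_pos
  refine ⟨‖D.u 0‖ / 2 * c₁ / C', min r₁ r₂, by positivity, lt_min hr₁ hr₂,
    fun t y ht0 ht hy z hz0 hzy hz => ?_⟩
  rcases hz0.eq_or_lt with rfl | hzpos
  · rw [Real.zero_rpow hT.ne', mul_zero, mul_zero]
    exact norm_nonneg _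
  have hy0 : 0 < ‖y‖ := hzpos.trans_le hzy
  have htpos : 0 < ‖t‖ := norm_pos_iff.2 ht0
  rw [lt_min_iff] at ht hy
  obtain ⟨h1, h2, h3⟩ := hloc t y ht.2 hy.2
  have h4 := h1 ht0 y z hz0 hzy hz
  have h5 : ‖t ^ D.n‖ ^ T * ‖y‖ ^ T ≤ C' * D.genericSize k ‖t‖ ‖y‖ := by
    rw [norm_pow]
    refine (hC ‖t‖ ‖y‖ htpos ht.1 hy0 hy.1).trans ?_
    gcongr
    · exact D.genericSize_nonneg k htpos.le hy0.le
    · exact le_max_left _ _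
  have hyT : 0 < ‖y‖ ^ T := Real.rpow_pos_of_pos hy0 T
  -- Multiplying by `‖y‖ ^ T` lets the polyhedron estimate `h5` and the root estimate `h4` be
  -- chained through the generic size.
  refine le_of_mul_le_mul_right ?_ hyT
  simp only at h2 h3
  rw [h3, NewtonPuiseux.PuiseuxData.eval]
  simp only [norm_mul, norm_pow, norm_prod]
  calc _ = ‖D.u 0‖ / 2 * c₁ * z ^ T / C' * (‖t ^ D.n‖ ^ T * ‖y‖ ^ T) := by
        rw [norm_pow]; ring
    _ ≤ ‖D.u 0‖ / 2 * c₁ * z ^ T / C' * (C' * D.genericSize k ‖t‖ ‖y‖) := by gcongr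
    _ = ‖D.u 0‖ / 2 * ((‖t‖ ^ D.n) ^ D.α * ‖y‖ ^ D.β *
          (c₁ * (z ^ T * ∏ ν, (‖y‖ + ‖t‖ ^ k ν)))) := by
        rw [NewtonPuiseux.PuiseuxData.genericSize]
        field_simp
    _ ≤ ‖D.u (t, y)‖ * ((‖t‖ ^ D.n) ^ D.α * ‖y‖ ^ D.β *
          (‖y‖ ^ T * ∏ ν, ‖y - D.ψ ν t‖)) := by
        gcongr
    _ = _ := by ring

/-! ### Convergence and divergence of the integrals. -/

section Integrals

variable {𝕜 : Type*} [RCLike 𝕜] [MeasureSpace 𝕜] [BorelSpace 𝕜]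
  [(volume : Measure 𝕜).IsAddHaarMeasure]

theorem lintegral_ball_enorm_rpow_neg_lt_top {s : ℝ} (hs : s < Module.finrank ℝ 𝕜) (R : ℝ) :
    ∫⁻ y in Metric.ball (0 : 𝕜) R, ‖y‖ₑ ^ (-s) < ⊤ := by
  have hd : 1 ≤ Module.finrank ℝ 𝕜 := Module.finrank_pos
  have h1 : IntegrableOn (fun y : 𝕜 => ‖y‖ ^ (-s)) (Metric.ball 0 R) := by
    refine integrableOn_ball_of_norm_le_rpow hd hs (C := 1) (Eventually.of_forall fun y => ?_) ?_
    · rw [one_mul, Real.norm_of_nonneg (by positivity)]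
    · exact (measurable_norm.pow_const _).aestronglyMeasurable
  have h2 := h1.hasFiniteIntegral
  rw [HasFiniteIntegral] at h2
  refine lt_of_le_of_lt (lintegral_mono_ae ?_) h2
  have h3 : ∀ᵐ y ∂(volume.restrict (Metric.ball (0 : 𝕜) R)), y ≠ 0 :=
    ae_restrict_of_ae (Measure.ae_ne volume 0)
  filter_upwards [h3] with y hy
  have hy0 : 0 < ‖y‖ := norm_pos_iff.2 hy
  rw [Real.enorm_of_nonneg (by positivity), ← ENNReal.ofReal_rpow_of_pos hy0, ofReal_norm]

/-- The bound must be uniform in `w`, because the roots move with `x`. Points within `R` of `w` are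
handled by translation, and elsewhere the integrand is at most `R ^ (-s)`. -/
theorem exists_lintegral_ball_enorm_sub_rpow_neg_le {s : ℝ} (hs0 : 0 ≤ s)
    (hs : s < Module.finrank ℝ 𝕜) {R : ℝ} (hR : 0 < R) :
    ∃ K : ENNReal, K < ⊤ ∧ ∀ w : 𝕜, ∫⁻ y in Metric.ball (0 : 𝕜) R, ‖y - w‖ₑ ^ (-s) ≤ K := by
  refine ⟨(∫⁻ y in Metric.ball (0 : 𝕜) R, ‖y‖ₑ ^ (-s)) +
    ENNReal.ofReal (R ^ (-s)) * volume (Metric.ball (0 : 𝕜) R),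
    ENNReal.add_lt_top.2 ⟨lintegral_ball_enorm_rpow_neg_lt_top hs R,
      ENNReal.mul_lt_top ENNReal.ofReal_lt_top measure_ball_lt_top⟩, fun w => ?_⟩
  set g : 𝕜 → ENNReal := (Metric.ball (0 : 𝕜) R).indicator fun y => ‖y‖ₑ ^ (-s) with hg
  have hgm : Measurable g :=
    (measurable_enorm.pow_const _).indicator Metric.isOpen_ball.measurableSet
  have h1 : ∀ y : 𝕜, ‖y - w‖ₑ ^ (-s) ≤ g (y - w) + ENNReal.ofReal (R ^ (-s)) := by
    intro y
    by_cases hy : y - w ∈ Metric.ball (0 : 𝕜) R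
    · rw [hg, Set.indicator_of_mem hy]
      exact le_self_add
    · rw [mem_ball_zero_iff, not_lt] at hy
      refine le_add_left ?_
      rw [← ENNReal.ofReal_rpow_of_pos hR, ENNReal.rpow_neg, ENNReal.rpow_neg, ENNReal.inv_le_inv]
      refine ENNReal.rpow_le_rpow ?_ hs0
      rw [← ofReal_norm]
      exact ENNReal.ofReal_le_ofReal hy
  calc ∫⁻ y in Metric.ball (0 : 𝕜) R, ‖y - w‖ₑ ^ (-s)
      ≤ ∫⁻ y in Metric.ball (0 : 𝕜) R, (g (y - w) + ENNReal.ofReal (R ^ (-s))) :=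
        lintegral_mono h1
    _ = (∫⁻ y in Metric.ball (0 : 𝕜) R, g (y - w)) +
          ENNReal.ofReal (R ^ (-s)) * volume (Metric.ball (0 : 𝕜) R) := by
        rw [lintegral_add_right _ measurable_const, setLIntegral_const]
    _ ≤ (∫⁻ y, g (y - w)) + ENNReal.ofReal (R ^ (-s)) * volume (Metric.ball (0 : 𝕜) R) := by
        gcongr
        exact Measure.restrict_le_self
    _ = _ := by
        rw [lintegral_sub_right_eq_self g w, hg,
          lintegral_indicator Metric.isOpen_ball.measurableSet]

theorem euclBall_subset_prod_ball {𝕜 : Type*} [NormedField 𝕜] {r : ℝ} (hr : 0 < r) :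
    NewtonPuiseux.euclBall 𝕜 r ⊆ Metric.ball 0 r ×ˢ Metric.ball 0 r := by
  rintro ⟨x, y⟩ h
  simp only [NewtonPuiseux.euclBall, Set.mem_ofPred_eq] at h
  refine ⟨?_, ?_⟩ <;> rw [mem_ball_zero_iff] <;> refine lt_of_pow_lt_pow_left₀ 2 hr.le ?_
  · nlinarith [sq_nonneg ‖y‖]
  · nlinarith [sq_nonneg ‖x‖]

theorem prod_ball_subset_euclBall {𝕜 : Type*} [NormedField 𝕜] {r₁ r₂ r : ℝ} (h₁ : 0 < r₁)
    (h₁' : r₁ ≤ r / 2) (h₂' : r₂ ≤ r / 2) :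
    Metric.ball 0 r₁ ×ˢ Metric.ball 0 r₂ ⊆ NewtonPuiseux.euclBall 𝕜 r := by
  rintro ⟨x, y⟩ ⟨hx, hy⟩
  rw [mem_ball_zero_iff] at hx hy
  simp only at hx hy
  simp only [NewtonPuiseux.euclBall, Set.mem_ofPred_eq]
  have hx' : ‖x‖ ^ 2 ≤ (r / 2) ^ 2 := by gcongr; linarith
  have hy' : ‖y‖ ^ 2 ≤ (r / 2) ^ 2 := by gcongr; linarith
  nlinarith

/-- Local integrability of `‖f‖ ^ (-c)` for a function bounded below, at each `(x, y)`, by the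
`T`-th power of the product of `‖x‖` and the distance of `y` to one of finitely many points. -/
theorem lintegral_euclBall_lt_top {f : 𝕜 × 𝕜 → 𝕜} {ι : Type*} [Fintype ι] {C r T c : ℝ}
    (hC : 0 < C) (hr : 0 < r) (hT : 0 < T) (hc : 0 < c) (hcT : c * T < Module.finrank ℝ 𝕜)
    (h : ∀ x : 𝕜, x ≠ 0 → ‖x‖ < r → ∃ w : ι → 𝕜, ∀ y : 𝕜, ‖y‖ < r →
      ∃ i, C * (‖x‖ ^ T * ‖y - w i‖ ^ T) ≤ ‖f (x, y)‖) :
    ∫⁻ z in NewtonPuiseux.euclBall 𝕜 r, ‖f z‖ₑ ^ (-c) < ⊤ := by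
  obtain ⟨K, hK, hKw⟩ := exists_lintegral_ball_enorm_sub_rpow_neg_le (𝕜 := 𝕜)
    (mul_pos hc hT).le hcT hr
  set A : ENNReal := ENNReal.ofReal C ^ (-c) with hA
  have hAtop : A ≠ ⊤ := by
    rw [hA, ENNReal.ofReal_rpow_of_pos hC]
    exact ENNReal.ofReal_ne_top
  have hrpow : ∀ e : ENNReal, (e ^ T) ^ (-c) = e ^ (-(c * T)) := fun e => by
    rw [← ENNReal.rpow_mul]
    congr 1
    ring
  have hpt : ∀ x : 𝕜, x ≠ 0 → ‖x‖ < r → ∃ w : ι → 𝕜, ∀ y : 𝕜, ‖y‖ < r →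
      ‖f (x, y)‖ₑ ^ (-c) ≤ A * ‖x‖ₑ ^ (-(c * T)) * ∑ i, ‖y - w i‖ₑ ^ (-(c * T)) := by
    intro x hx0 hx
    obtain ⟨w, hw⟩ := h x hx0 hx
    refine ⟨w, fun y hy => ?_⟩
    obtain ⟨i, hi⟩ := hw y hy
    have h1 : ENNReal.ofReal C * (‖x‖ₑ ^ T * ‖y - w i‖ₑ ^ T) ≤ ‖f (x, y)‖ₑ := by
      rw [← ofReal_norm (f (x, y)), ← ofReal_norm x, ← ofReal_norm (y - w i),
        ENNReal.ofReal_rpow_of_nonneg (norm_nonneg _) hT.le,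
        ENNReal.ofReal_rpow_of_nonneg (norm_nonneg _) hT.le,
        ← ENNReal.ofReal_mul (by positivity), ← ENNReal.ofReal_mul hC.le]
      exact ENNReal.ofReal_le_ofReal hi
    have htop : ∀ v : 𝕜, ‖v‖ₑ ^ T ≠ ⊤ := fun v =>
      ENNReal.rpow_ne_top_of_nonneg hT.le enorm_ne_top
    calc ‖f (x, y)‖ₑ ^ (-c)
        ≤ (ENNReal.ofReal C * (‖x‖ₑ ^ T * ‖y - w i‖ₑ ^ T)) ^ (-c) := by
          rw [ENNReal.rpow_neg, ENNReal.rpow_neg, ENNReal.inv_le_inv]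
          exact ENNReal.rpow_le_rpow h1 hc.le
      _ = A * ‖x‖ₑ ^ (-(c * T)) * ‖y - w i‖ₑ ^ (-(c * T)) := by
          rw [ENNReal.mul_rpow_of_ne_top ENNReal.ofReal_ne_top (ENNReal.mul_ne_top (htop _) (htop _)),
            ENNReal.mul_rpow_of_ne_top (htop _) (htop _), hrpow, hrpow, mul_assoc]
      -- Summing over all `i` removes the dependence of the nearest point on `y`.
      _ ≤ _ := by
          gcongr
          exact Finset.single_le_sum (f := fun i => ‖y - w i‖ₑ ^ (-(c * T)))
            (fun _ _ => zero_le) (Finset.mem_univ i)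
  have hinner : ∀ x : 𝕜, x ≠ 0 → ‖x‖ < r →
      ∫⁻ y in Metric.ball (0 : 𝕜) r, ‖f (x, y)‖ₑ ^ (-c) ≤
        A * (Fintype.card ι * K) * ‖x‖ₑ ^ (-(c * T)) := by
    intro x hx0 hx
    obtain ⟨w, hw⟩ := hpt x hx0 hx
    have hmeas : ∀ i, Measurable fun y : 𝕜 => ‖y - w i‖ₑ ^ (-(c * T)) := fun i =>
      (measurable_id.sub_const (w i)).enorm.pow_const _
    calc ∫⁻ y in Metric.ball (0 : 𝕜) r, ‖f (x, y)‖ₑ ^ (-c)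
        ≤ ∫⁻ y in Metric.ball (0 : 𝕜) r,
            A * ‖x‖ₑ ^ (-(c * T)) * ∑ i, ‖y - w i‖ₑ ^ (-(c * T)) :=
          setLIntegral_mono' Metric.isOpen_ball.measurableSet fun y hy =>
            hw y (mem_ball_zero_iff.1 hy)
      _ = A * ‖x‖ₑ ^ (-(c * T)) *
            ∑ i, ∫⁻ y in Metric.ball (0 : 𝕜) r, ‖y - w i‖ₑ ^ (-(c * T)) := by
          rw [lintegral_const_mul _ (Finset.measurable_fun_sum _ fun i _ => hmeas i),
            lintegral_finsetSum _ fun i _ => hmeas i]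
      _ ≤ A * ‖x‖ₑ ^ (-(c * T)) * ∑ _i : ι, K := by
          gcongr with i
          exact hKw (w i)
      _ = _ := by
          rw [Finset.sum_const, Finset.card_univ, nsmul_eq_mul]
          ring
  calc ∫⁻ z in NewtonPuiseux.euclBall 𝕜 r, ‖f z‖ₑ ^ (-c)
      ≤ ∫⁻ z in Metric.ball (0 : 𝕜) r ×ˢ Metric.ball (0 : 𝕜) r, ‖f z‖ₑ ^ (-c) :=
        lintegral_mono_set (euclBall_subset_prod_ball hr)
    _ ≤ ∫⁻ x in Metric.ball (0 : 𝕜) r, ∫⁻ y in Metric.ball (0 : 𝕜) r, ‖f (x, y)‖ₑ ^ (-c) := by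
        rw [Measure.volume_eq_prod, ← Measure.prod_restrict]
        -- This half of Tonelli's theorem holds without measurability of the integrand.
        exact lintegral_prod_le _
    _ ≤ ∫⁻ x in Metric.ball (0 : 𝕜) r, A * (Fintype.card ι * K) * ‖x‖ₑ ^ (-(c * T)) := by
        refine lintegral_mono_ae ?_
        have h3 : ∀ᵐ y ∂(volume.restrict (Metric.ball (0 : 𝕜) r)), y ≠ 0 :=
          ae_restrict_of_ae (Measure.ae_ne volume 0)
        filter_upwards [h3, ae_restrict_mem Metric.isOpen_ball.measurableSet] with x hx0 hx
        exact hinner x hx0 (mem_ball_zero_iff.1 hx)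
    _ = A * (Fintype.card ι * K) * ∫⁻ x in Metric.ball (0 : 𝕜) r, ‖x‖ₑ ^ (-(c * T)) :=
        lintegral_const_mul _ (measurable_enorm.pow_const _)
    _ < ⊤ := ENNReal.mul_lt_top (ENNReal.mul_lt_top hAtop.lt_top
        (ENNReal.mul_lt_top (ENNReal.natCast_lt_top _) hK))
        (lintegral_ball_enorm_rpow_neg_lt_top hcT r)

/-- Divergence of the integral of `‖f‖ ^ (-c)` for a function that is `O(s ^ T)` on the boxes
`‖x‖ < ρ s ^ κ₁`, `‖y‖ < ρ s ^ κ₂`. -/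
theorem lintegral_euclBall_eq_top {f : 𝕜 × 𝕜 → 𝕜} {κ₁ κ₂ T c M ρ ε : ℝ} (hM : 0 < M)
    (hρ : 0 < ρ) (hρε : ρ ≤ ε / 2) (h₁ : 0 ≤ κ₁) (h₂ : 0 ≤ κ₂) (hκ : κ₁ + κ₂ = 1) (hc : 0 < c)
    (hcT : Module.finrank ℝ 𝕜 < c * T)
    (hf : ∀ s : ℝ, 0 < s → s ≤ 1 → ∀ x y : 𝕜, ‖x‖ < ρ * s ^ κ₁ → ‖y‖ < ρ * s ^ κ₂ →
      ‖f (x, y)‖ ≤ M * s ^ T) :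
    ∫⁻ z in NewtonPuiseux.euclBall 𝕜 ε, ‖f z‖ₑ ^ (-c) = ⊤ := by
  set d := Module.finrank ℝ 𝕜 with hd
  set V : ENNReal := volume (Metric.ball (0 : 𝕜) 1) with hV
  have hV0 : V ≠ 0 := (Metric.measure_ball_pos volume (0 : 𝕜) one_pos).ne'
  set B : ENNReal := ENNReal.ofReal (M ^ (-c) * (ρ ^ d * ρ ^ d)) * (V * V) with hB
  have hB0 : B ≠ 0 := by
    refine mul_ne_zero ?_ (mul_ne_zero hV0 hV0)
    rw [Ne, ENNReal.ofReal_eq_zero, not_le]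
    positivity
  have hlow : ∀ s : ℝ, 0 < s → s ≤ 1 → ENNReal.ofReal (s ^ (d - c * T)) * B ≤
      ∫⁻ z in NewtonPuiseux.euclBall 𝕜 ε, ‖f z‖ₑ ^ (-c) := by
    intro s hs hs1
    have hs₁ : s ^ κ₁ ≤ 1 := Real.rpow_le_one hs.le hs1 h₁
    have hs₂ : s ^ κ₂ ≤ 1 := Real.rpow_le_one hs.le hs1 h₂
    have hbox : Metric.ball (0 : 𝕜) (ρ * s ^ κ₁) ×ˢ Metric.ball (0 : 𝕜) (ρ * s ^ κ₂) ⊆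
        NewtonPuiseux.euclBall 𝕜 ε :=
      prod_ball_subset_euclBall (by positivity) (by nlinarith) (by nlinarith)
    have hvol : (volume : Measure (𝕜 × 𝕜))
        (Metric.ball (0 : 𝕜) (ρ * s ^ κ₁) ×ˢ Metric.ball (0 : 𝕜) (ρ * s ^ κ₂)) =
          ENNReal.ofReal (ρ ^ d * ρ ^ d * s ^ (d : ℝ)) * (V * V) := by
      have hball : ∀ R : ℝ, 0 ≤ R →
          volume (Metric.ball (0 : 𝕜) R) = ENNReal.ofReal (R ^ d) * V :=
        fun R hR => Measure.addHaar_ball volume 0 hR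
      rw [Measure.volume_eq_prod, Measure.prod_prod, hball _ (by positivity),
        hball _ (by positivity), mul_mul_mul_comm,
        ← ENNReal.ofReal_mul (by positivity)]
      congr 2
      rw [mul_pow, mul_pow, mul_mul_mul_comm, ← mul_pow, ← mul_pow (s ^ κ₁), ← Real.rpow_add hs, hκ,
        Real.rpow_one, Real.rpow_natCast, mul_pow]
    calc ENNReal.ofReal (s ^ (d - c * T)) * B
        = ENNReal.ofReal ((M * s ^ T) ^ (-c)) *
            (ENNReal.ofReal (ρ ^ d * ρ ^ d * s ^ (d : ℝ)) * (V * V)) := by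
          rw [hB, ← mul_assoc, ← mul_assoc _ _ (V * V), ← ENNReal.ofReal_mul (by positivity),
            ← ENNReal.ofReal_mul (by positivity)]
          congr 2
          rw [Real.mul_rpow hM.le (by positivity), ← Real.rpow_mul hs.le, sub_eq_add_neg,
            Real.rpow_add hs, show T * -c = -(c * T) by ring]
          ring
      _ = ∫⁻ _z in Metric.ball (0 : 𝕜) (ρ * s ^ κ₁) ×ˢ Metric.ball (0 : 𝕜) (ρ * s ^ κ₂),
            ENNReal.ofReal ((M * s ^ T) ^ (-c)) := by
          rw [setLIntegral_const, hvol]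
      _ ≤ ∫⁻ z in Metric.ball (0 : 𝕜) (ρ * s ^ κ₁) ×ˢ Metric.ball (0 : 𝕜) (ρ * s ^ κ₂),
            ‖f z‖ₑ ^ (-c) := by
          refine setLIntegral_mono'
            (Metric.isOpen_ball.measurableSet.prod Metric.isOpen_ball.measurableSet) ?_
          rintro ⟨x, y⟩ ⟨hx, hy⟩
          rw [← ENNReal.ofReal_rpow_of_pos (by positivity), ENNReal.rpow_neg, ENNReal.rpow_neg,
            ENNReal.inv_le_inv]
          refine ENNReal.rpow_le_rpow ?_ hc.le
          rw [← ofReal_norm]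
          exact ENNReal.ofReal_le_ofReal
            (hf s hs hs1 x y (mem_ball_zero_iff.1 hx) (mem_ball_zero_iff.1 hy))
      _ ≤ _ := lintegral_mono_set hbox
  -- The lower bounds `hlow` are read at `s = v⁻¹`, with `v → ∞`.
  have hlim : Tendsto (fun v : ℝ => ENNReal.ofReal (v ^ (c * T - d)) * B) atTop (𝓝 ⊤) := by
    have h1 : Tendsto (fun v : ℝ => ENNReal.ofReal (v ^ (c * T - d))) atTop (𝓝 ⊤) :=
      ENNReal.tendsto_ofReal_atTop.comp (tendsto_rpow_atTop (by linarith))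
    have h2 := ENNReal.Tendsto.mul_const (b := B) h1 (Or.inl ENNReal.top_ne_zero)
    rwa [ENNReal.top_mul hB0] at h2
  refine top_le_iff.1 (le_of_tendsto hlim ?_)
  filter_upwards [eventually_ge_atTop (1 : ℝ)] with v hv
  have hv0 : 0 < v := by linarith
  have h3 := hlow v⁻¹ (inv_pos.2 hv0) (inv_le_one_of_one_le₀ hv)
  rwa [Real.inv_rpow hv0.le, ← Real.rpow_neg hv0.le, neg_sub] at h3

end Integrals

/-! ### Convex geometry of the Newton polyhedron. -/

section Polyhedron

/-- The convex hull of the union of the orthants with vertices in `S`. -/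
def orthantHull (S : Set (ℕ × ℕ)) : Set (ℝ × ℝ) :=
  convexHull ℝ {w | ∃ p q : ℕ, (p, q) ∈ S ∧ (p : ℝ) ≤ w.1 ∧ (q : ℝ) ≤ w.2}

variable {S : Set (ℕ × ℕ)}

theorem mem_orthantHull_of_le {w v : ℝ × ℝ} (hw : w ∈ orthantHull S) (h₁ : w.1 ≤ v.1)
    (h₂ : w.2 ≤ v.2) : v ∈ orthantHull S := by
  have h : orthantHull S ⊆ (fun z => (v - w) + z) ⁻¹' orthantHull S := by
    refine convexHull_min ?_ ((convex_convexHull ℝ _).translate_preimage_right _)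
    rintro z ⟨p, q, hpq, hp, hq⟩
    refine subset_convexHull ℝ _ ⟨p, q, hpq, ?_, ?_⟩
    · simp only [Prod.fst_add, Prod.fst_sub]
      linarith
    · simp only [Prod.snd_add, Prod.snd_sub]
      linarith
  simpa using h hw

/-- A half-plane that contains all generators contains their hull. This keeps the diagonal infimum
positive and makes the condition `0 ≤ t` automatic for diagonal points. -/
theorem one_le_of_mem_orthantHull (h0 : (0, 0) ∉ S) {w : ℝ × ℝ} (hw : w ∈ orthantHull S) :
    1 ≤ w.1 + w.2 := by
  refine convexHull_min (t := {w : ℝ × ℝ | 1 ≤ w.1 + w.2}) ?_ ?_ hw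
  · rintro z ⟨p, q, hpq, hp, hq⟩
    have h1 : 1 ≤ p + q := by
      by_contra! hlt
      obtain ⟨rfl, rfl⟩ : p = 0 ∧ q = 0 := by omega
      exact h0 hpq
    have h2 : (1 : ℝ) ≤ p + q := by exact_mod_cast h1
    simp only [Set.mem_ofPred_eq]
    linarith
  · exact convex_halfSpace_ge (IsLinearMap.mk (fun _ _ => by simp only [Prod.fst_add, Prod.snd_add]; ring)
      fun _ _ => by simp only [Prod.smul_fst, Prod.smul_snd, smul_eq_mul]; ring) 1

/-- The parameters of the points of the diagonal that lie in the polyhedron. -/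
def diagonalSet (S : Set (ℕ × ℕ)) : Set ℝ := {t : ℝ | 0 ≤ t ∧ (t, t) ∈ orthantHull S}

theorem bddBelow_diagonalSet (S : Set (ℕ × ℕ)) : BddBelow (diagonalSet S) := ⟨0, fun _ h => h.1⟩

theorem diagonalSet_nonempty (hS : S.Nonempty) : (diagonalSet S).Nonempty := by
  obtain ⟨⟨p, q⟩, h⟩ := hS
  exact ⟨p + q, by positivity, subset_convexHull ℝ _ ⟨p, q, h, by simp, by simp⟩⟩

theorem sInf_diagonalSet_pos (hS : S.Nonempty) (h0 : (0, 0) ∉ S) : 0 < sInf (diagonalSet S) := by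
  refine lt_of_lt_of_le (by norm_num : (0 : ℝ) < 1 / 2) (le_csInf (diagonalSet_nonempty hS) ?_)
  rintro t ⟨-, ht⟩
  have := one_le_of_mem_orthantHull h0 ht
  simp only at this
  linarith

/-- A supporting line of the polyhedron at its boundary point on the diagonal. -/
theorem exists_supporting_line (hS : S.Nonempty) (h0 : (0, 0) ∉ S) :
    ∃ κ₁ κ₂ : ℝ, 0 ≤ κ₁ ∧ 0 ≤ κ₂ ∧ κ₁ + κ₂ = 1 ∧
      ∀ p q : ℕ, (p, q) ∈ S → sInf (diagonalSet S) ≤ κ₁ * p + κ₂ * q := by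
  set T := sInf (diagonalSet S) with hT
  -- A common point would, after raising both coordinates to their maximum, give a diagonal point of
  -- the hull below `T`. Separating this open quadrant, which is unbounded below, forces nonnegative
  -- weights.
  have hdisj : Disjoint (Set.Iio T ×ˢ Set.Iio T) (orthantHull S) := by
    rw [Set.disjoint_left]
    rintro w ⟨hw1, hw2⟩ hw
    have hlt : max w.1 w.2 < T := max_lt hw1 hw2
    have h1 : (max w.1 w.2, max w.1 w.2) ∈ orthantHull S :=
      mem_orthantHull_of_le hw (le_max_left _ _) (le_max_right _ _)
    have h2 := one_le_of_mem_orthantHull h0 h1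
    simp only at h2
    exact absurd (csInf_le (bddBelow_diagonalSet S) ⟨by linarith, h1⟩) (not_le.2 hlt)
  obtain ⟨l, u, hl, hu⟩ := geometric_hahn_banach_open ((convex_Iio T).prod (convex_Iio T))
    (isOpen_Iio.prod isOpen_Iio) (convex_convexHull ℝ _) hdisj
  set a := l (1, 0)
  set b := l (0, 1)
  have hlw : ∀ x y : ℝ, l (x, y) = a * x + b * y := fun x y => by
    have : ((x, y) : ℝ × ℝ) = x • (1, 0) + y • (0, 1) := by simp
    rw [this, map_add, map_smul, map_smul, smul_eq_mul, smul_eq_mul]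
    ring
  have hq : ∀ x y : ℝ, x < T → y < T → a * x + b * y < u := fun x y hx hy => by
    rw [← hlw]
    exact hl (x, y) ⟨hx, hy⟩
  have ha : 0 ≤ a := by
    by_contra! ha
    have h1 := hq (min (T - 1) ((u - b * (T - 1)) / a)) (T - 1)
      ((min_le_left _ _).trans_lt (by linarith)) (by linarith)
    have h2 := mul_le_mul_of_nonpos_left (min_le_right (T - 1) ((u - b * (T - 1)) / a)) ha.le
    rw [mul_div_cancel₀ _ ha.ne] at h2
    linarith
  have hb : 0 ≤ b := by
    by_contra! hb
    have h1 := hq (T - 1) (min (T - 1) ((u - a * (T - 1)) / b)) (by linarith)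
      ((min_le_left _ _).trans_lt (by linarith))
    have h2 := mul_le_mul_of_nonpos_left (min_le_right (T - 1) ((u - a * (T - 1)) / b)) hb.le
    rw [mul_div_cancel₀ _ hb.ne] at h2
    linarith
  have hTu : (a + b) * T ≤ u := by
    refine le_of_forall_pos_lt_add fun η hη => ?_
    have h1 := hq (T - η / (a + b + 1)) (T - η / (a + b + 1))
      (by linarith [div_pos hη (by linarith : 0 < a + b + 1)])
      (by linarith [div_pos hη (by linarith : 0 < a + b + 1)])
    have h2 : (a + b) * (η / (a + b + 1)) ≤ η := by
      rw [mul_div_assoc', div_le_iff₀ (by linarith)]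
      nlinarith
    linarith
  have hup : ∀ p q : ℕ, (p, q) ∈ S → u ≤ a * p + b * q := fun p q h => by
    rw [← hlw]
    exact hu _ (subset_convexHull ℝ _ ⟨p, q, h, le_rfl, le_rfl⟩)
  have hab : 0 < a + b := by
    rcases (add_nonneg ha hb).eq_or_lt with h | h
    · have ha0 : a = 0 := by linarith
      have hb0 : b = 0 := by linarith
      obtain ⟨⟨p, q⟩, hpq⟩ := hS
      have h1 := hup p q hpq
      have h2 := hq (T - 1) (T - 1) (by linarith) (by linarith)
      rw [ha0, hb0] at h1 h2
      linarith
    · exact h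
  refine ⟨a / (a + b), b / (a + b), by positivity, by positivity, by field_simp,
    fun p q h => ?_⟩
  rw [div_mul_eq_mul_div, div_mul_eq_mul_div, ← add_div, le_div_iff₀ hab, mul_comm]
  exact hTu.trans (hup p q h)

end Polyhedron

/-! ### From the series to the critical index. -/

theorem HasDoubleSeries.norm_le_on_box {𝕜 : Type*} [NontriviallyNormedField 𝕜] {f : 𝕜 × 𝕜 → 𝕜}
    {a : ℕ × ℕ → 𝕜} {r κ₁ κ₂ T : ℝ} (h : HasDoubleSeries f a r) (h₁ : 0 ≤ κ₁) (h₂ : 0 ≤ κ₂)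
    (hT : ∀ p q : ℕ, a (p, q) ≠ 0 → T ≤ κ₁ * p + κ₂ * q) :
    ∃ M : ℝ, 0 < M ∧ ∀ ρ, 0 < ρ → ρ ≤ r → ∀ s : ℝ, 0 < s → s ≤ 1 → ∀ x y : 𝕜,
      ‖x‖ < ρ * s ^ κ₁ → ‖y‖ < ρ * s ^ κ₂ → ‖f (x, y)‖ ≤ M * s ^ T := by
  refine ⟨∑' m : ℕ × ℕ, ‖a m‖ * r ^ (m.1 + m.2) + 1, ?_, fun ρ hρ hρr s hs hs1 x y hx hy => ?_⟩
  · have : 0 ≤ ∑' m : ℕ × ℕ, ‖a m‖ * r ^ (m.1 + m.2) :=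
      tsum_nonneg fun m => mul_nonneg (norm_nonneg _) (pow_nonneg h.r_pos.le _)
    linarith
  have hs₁ : s ^ κ₁ ≤ 1 := Real.rpow_le_one hs.le hs1 h₁
  have hs₂ : s ^ κ₂ ≤ 1 := Real.rpow_le_one hs.le hs1 h₂
  have hp₁ : 0 < s ^ κ₁ := Real.rpow_pos_of_pos hs _
  have hp₂ : 0 < s ^ κ₂ := Real.rpow_pos_of_pos hs _
  have hsum := h.hasSum x y (by nlinarith) (by nlinarith)
  have hbound : ∀ m : ℕ × ℕ, ‖a m * (x ^ m.1 * y ^ m.2)‖ ≤ ‖a m‖ * r ^ (m.1 + m.2) * s ^ T := by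
    rintro ⟨p, q⟩
    by_cases ha : a (p, q) = 0
    · simp [ha]
    have hr0 := h.r_pos
    calc ‖a (p, q) * (x ^ p * y ^ q)‖ = ‖a (p, q)‖ * (‖x‖ ^ p * ‖y‖ ^ q) := by
          rw [norm_mul, norm_mul, norm_pow, norm_pow]
      _ ≤ ‖a (p, q)‖ * ((r * s ^ κ₁) ^ p * (r * s ^ κ₂) ^ q) := by
          gcongr
          · exact hx.le.trans (by gcongr)
          · exact hy.le.trans (by gcongr)
      _ = ‖a (p, q)‖ * r ^ (p + q) * s ^ (κ₁ * p + κ₂ * q) := by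
          rw [Real.rpow_add hs, Real.rpow_mul hs.le, Real.rpow_mul hs.le, Real.rpow_natCast,
            Real.rpow_natCast, mul_pow, mul_pow, pow_add]
          ring
      _ ≤ ‖a (p, q)‖ * r ^ (p + q) * s ^ T := by
          gcongr ?_ * ?_
          exact Real.rpow_le_rpow_of_exponent_ge hs hs1 (hT p q ha)
  have h3 := tsum_of_norm_bounded (h.summable.mul_right (s ^ T)).hasSum hbound
  rw [hsum.tsum_eq, tsum_mul_right] at h3
  refine h3.trans ?_
  gcongr
  linarith

theorem HasDoubleSeries.newtonPolyhedron_eq {𝕜 : Type*} [NontriviallyNormedField 𝕜]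
    [CompleteSpace 𝕜] [CharZero 𝕜] {f : 𝕜 × 𝕜 → 𝕜} {a : ℕ × ℕ → 𝕜} {r : ℝ}
    (h : HasDoubleSeries f a r) :
    NewtonPuiseux.newtonPolyhedron f = orthantHull {m | a m ≠ 0} := by
  simp only [NewtonPuiseux.newtonPolyhedron, orthantHull, h.taylorCoeff_eq, Set.mem_ofPred_eq]

theorem HasDoubleSeries.newtonDist_eq {𝕜 : Type*} [NontriviallyNormedField 𝕜]
    [CompleteSpace 𝕜] [CharZero 𝕜] {f : 𝕜 × 𝕜 → 𝕜} {a : ℕ × ℕ → 𝕜} {r : ℝ}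
    (h : HasDoubleSeries f a r) :
    NewtonPuiseux.newtonDist f = (sInf (diagonalSet {m | a m ≠ 0}))⁻¹ := by
  rw [NewtonPuiseux.newtonDist, h.newtonPolyhedron_eq, diagonalSet]

theorem HasDoubleSeries.coeff_zero {𝕜 : Type*} [NontriviallyNormedField 𝕜]
    {f : 𝕜 × 𝕜 → 𝕜} {a : ℕ × ℕ → 𝕜} {r : ℝ} (h : HasDoubleSeries f a r) (h0 : f 0 = 0) :
    a (0, 0) = 0 := by
  have h1 := h.hasSum 0 0 (by simpa using h.r_pos) (by simpa using h.r_pos)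
  have h2 := hasSum_single (f := fun m : ℕ × ℕ => a m * ((0 : 𝕜) ^ m.1 * 0 ^ m.2)) (0, 0) <| by
    rintro ⟨p, q⟩ hpq
    rcases Nat.eq_zero_or_pos p with rfl | hp
    · have hq : q ≠ 0 := fun hq => hpq (by rw [hq])
      simp [hq]
    · simp [hp.ne']
  have h3 := h1.unique h2
  rw [Prod.mk_zero_zero, h0] at h3
  simpa using h3.symm

theorem HasDoubleSeries.exists_coeff_ne_zero {𝕜 : Type*} [NontriviallyNormedField 𝕜]
    {f : 𝕜 × 𝕜 → 𝕜} {a : ℕ × ℕ → 𝕜} {r : ℝ} (h : HasDoubleSeries f a r)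
    (hne : ¬ ∀ᶠ z in 𝓝 (0 : 𝕜 × 𝕜), f z = 0) : {m | a m ≠ 0}.Nonempty := by
  by_contra hemp
  rw [Set.not_nonempty_iff_eq_empty, Set.eq_empty_iff_forall_notMem] at hemp
  refine hne ?_
  filter_upwards [Metric.ball_mem_nhds (0 : 𝕜 × 𝕜) h.r_pos] with z hz
  rw [mem_ball_zero_iff, Prod.norm_def, max_lt_iff] at hz
  refine (h.hasSum z.1 z.2 hz.1 hz.2).unique ?_
  have h1 : ∀ m, a m = 0 := fun m => by simpa using hemp m
  simp [h1, hasSum_zero]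

theorem NewtonPuiseux.criticalIndex_eq_of_threshold {𝕜 : Type*} [NormedField 𝕜] [MeasureSpace 𝕜]
    {f : 𝕜 × 𝕜 → 𝕜} {X : ℝ}
    (hlt : ∀ c : ℝ, 0 < c → c < X → ∃ ε : ℝ, 0 < ε ∧
      ∫⁻ z in NewtonPuiseux.euclBall 𝕜 ε, ‖f z‖ₑ ^ (-c) < ⊤)
    (hgt : ∀ c : ℝ, 0 < c → X < c → ∀ ε : ℝ, 0 < ε →
      ∫⁻ z in NewtonPuiseux.euclBall 𝕜 ε, ‖f z‖ₑ ^ (-c) = ⊤) :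
    NewtonPuiseux.criticalIndex f = ENNReal.ofReal X := by
  refine le_antisymm (sSup_le ?_) (le_of_forall_lt fun e he => ?_)
  · rintro _ ⟨c, ⟨hc, ε, hε, hfin⟩, rfl⟩
    refine ENNReal.ofReal_le_ofReal ?_
    by_contra! hX
    exact hfin.ne (hgt c hc hX ε hε)
  · obtain ⟨c, hec, hcX⟩ := ENNReal.lt_iff_exists_nnreal_btwn.1 he
    have hc : (0 : ℝ) < c := by
      have : (0 : ENNReal) < c := bot_le.trans_lt hec
      exact_mod_cast this
    rw [← ENNReal.ofReal_coe_nnreal, ENNReal.ofReal_lt_ofReal_iff_of_nonneg c.coe_nonneg] at hcX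
    refine hec.trans_le (le_sSup ⟨c, ⟨hc, hlt c hc hcX⟩, ENNReal.ofReal_coe_nnreal⟩)

/-- The critical integrability index of a function on `𝕜²`, in terms of a holomorphic extension
`F` along an isometric embedding `e : 𝕜 → ℂ` that has the contracting projection `π`. -/
theorem NewtonPuiseux.criticalIndex_eq {𝕜 : Type*} [RCLike 𝕜] [MeasureSpace 𝕜] [BorelSpace 𝕜]
    [(volume : Measure 𝕜).IsAddHaarMeasure] {f : 𝕜 × 𝕜 → 𝕜} {a : ℕ × ℕ → 𝕜} {r : ℝ}
    (hf : HasDoubleSeries f a r) (hf0 : f 0 = 0) (hne : ¬ ∀ᶠ z in 𝓝 (0 : 𝕜 × 𝕜), f z = 0)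
    {F : ℂ × ℂ → ℂ} {A : ℕ × ℕ → ℂ} (hF : HasDoubleSeries F A r) (hA : ∀ m, A m ≠ 0 ↔ a m ≠ 0)
    {e : 𝕜 → ℂ} {π : ℂ → 𝕜} (he : ∀ x, ‖e x‖ = ‖x‖) (hπ : ∀ y w, ‖y - π w‖ ≤ ‖e y - w‖)
    (hFf : ∀ x y : 𝕜, ‖x‖ < r → ‖y‖ < r → ‖F (e x, e y)‖ = ‖f (x, y)‖)
    {D : NewtonPuiseux.PuiseuxData} (hD : D.FactorsComplex F)
    (hm : ∀ α b, (D.mult α b : ℝ) ≤ (NewtonPuiseux.newtonDist f)⁻¹) :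
    NewtonPuiseux.criticalIndex f =
      ENNReal.ofReal (Module.finrank ℝ 𝕜 * NewtonPuiseux.newtonDist f) := by
  have hS := hf.exists_coeff_ne_zero hne
  have h0 : ((0, 0) : ℕ × ℕ) ∉ {m | a m ≠ 0} := by simp [hf.coeff_zero hf0]
  have hSA : {m | A m ≠ 0} = {m | a m ≠ 0} := by
    ext m
    exact hA m
  rw [hf.newtonDist_eq] at hm ⊢
  rw [inv_inv] at hm
  set T := sInf (diagonalSet {m | a m ≠ 0}) with hT
  have hT0 : 0 < T := sInf_diagonalSet_pos hS h0
  refine NewtonPuiseux.criticalIndex_eq_of_threshold (fun c hc hcT => ?_) (fun c hc hcT ε hε => ?_)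
  · have hTc : T < Module.finrank ℝ 𝕜 / c := by
      rw [← div_eq_mul_inv, lt_div_iff₀ hT0] at hcT
      rwa [lt_div_iff₀ hc, mul_comm]
    -- The strict inequality `c * T < d` leaves room for a diagonal point `(T', T')` of the
    -- polyhedron with `c * T' < d`, so the infimum need not be attained. The multiplicity bound
    -- survives because `T ≤ T'`.
    obtain ⟨T', ⟨-, hNP⟩, hT'⟩ := exists_lt_of_csInf_lt (diagonalSet_nonempty hS) hTc
    have hTT' : T ≤ T' := by
      by_contra! hlt
      have h1 := one_le_of_mem_orthantHull h0 hNP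
      simp only at h1
      exact absurd (csInf_le (bddBelow_diagonalSet _) ⟨by linarith, hNP⟩) (not_le.2 hlt)
    rw [← hSA, ← hF.newtonPolyhedron_eq] at hNP
    obtain ⟨C, r₁, hC, hr₁, hlow⟩ := NewtonPuiseux.PuiseuxData.exists_lower_bound hD hF.analyticAt
      (hT0.trans_le hTT') (fun α b => (hm α b).trans hTT') hNP
    set R := min (r₁ ^ D.n) (min r₁ r) with hR
    have hR0 : 0 < R := lt_min (pow_pos hr₁ _) (lt_min hr₁ hf.r_pos)
    refine ⟨R, hR0, lintegral_euclBall_lt_top (ι := Option (Fin D.N)) hC hR0 (hT0.trans_le hTT') hc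
      (by rwa [lt_div_iff₀ hc, mul_comm] at hT') fun x hx0 hx => ?_⟩
    rw [lt_min_iff, lt_min_iff] at hx
    obtain ⟨t, ht⟩ := IsAlgClosed.exists_pow_nat_eq (e x) D.n_pos
    have htx : ‖t‖ ^ D.n = ‖x‖ := by rw [← norm_pow, ht, he]
    have ht0 : t ≠ 0 := by
      rintro rfl
      rw [norm_zero, zero_pow D.n_pos.ne'] at htx
      exact hx0 (norm_eq_zero.1 htx.symm)
    have htr : ‖t‖ < r₁ := lt_of_pow_lt_pow_left₀ D.n hr₁.le (htx.trans_lt hx.1)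
    -- The value at `none` is `0`: the distance `z` in the lower bound must also be at most `‖y‖`.
    set W : Option (Fin D.N) → ℂ := fun i => i.elim 0 fun ν => D.ψ ν t with hW
    refine ⟨fun i => π (W i), fun y hy => ?_⟩
    rw [lt_min_iff, lt_min_iff] at hy
    obtain ⟨i, hi⟩ := Finite.exists_min fun i => ‖e y - W i‖
    refine ⟨i, ?_⟩
    have h1 := hlow t (e y) ht0 htr (by rw [he]; exact hy.2.1) ‖e y - W i‖ (norm_nonneg _)
      (by simpa [hW] using hi none) (fun ν => hi (some ν))
    rw [ht, hFf x y hx.2.2 hy.2.2, he] at h1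
    refine le_trans ?_ h1
    have hT'0 := (hT0.trans_le hTT').le
    gcongr
    exact hπ _ _
  · obtain ⟨κ₁, κ₂, h₁, h₂, hκ, hsupp⟩ := exists_supporting_line hS h0
    obtain ⟨M, hM, hbox⟩ := hf.norm_le_on_box h₁ h₂ hsupp
    refine lintegral_euclBall_eq_top hM (lt_min hf.r_pos (half_pos hε)) (min_le_right r (ε / 2))
      h₁ h₂ hκ hc ?_ (hbox _ (lt_min hf.r_pos (half_pos hε)) (min_le_left _ _))
    rw [← div_eq_mul_inv, div_lt_iff₀ hT0] at hcT
    exact hcT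

/-! ### Transfer between real and complex factorizations, and the conclusion. -/

theorem NewtonPuiseux.PuiseuxData.FactorsReal.factorsComplex {D : NewtonPuiseux.PuiseuxData}
    {f : ℝ × ℝ → ℝ} {F : ℂ × ℂ → ℂ} (hD : D.FactorsReal f) (hF : AnalyticAt ℂ F 0) {r : ℝ}
    (hr : 0 < r) (hFf : ∀ x y : ℝ, |x| < r → |y| < r → F (x, y) = f (x, y)) :
    D.FactorsComplex F := by
  have hψ : ∀ ν, AnalyticAt ℂ (fun z : ℂ × ℂ => D.ψ ν z.1) 0 := fun ν =>
    AnalyticAt.fun_comp (g := D.ψ ν) (f := Prod.fst) (x := (0 : ℂ × ℂ)) (D.ψ_analytic ν)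
      analyticAt_fst
  have hev : AnalyticAt ℂ (fun z : ℂ × ℂ => D.eval z.1 z.2) 0 := by
    unfold NewtonPuiseux.PuiseuxData.eval
    exact D.u_analytic.mul ((((analyticAt_fst.pow _).pow _).mul (analyticAt_snd.pow _)).mul
      (Finset.analyticAt_fun_prod _ fun ν _ => analyticAt_snd.sub (hψ ν)))
  have hz := ((analyticAt_pow_fst hF D.n_pos).sub hev).eventually_eq_zero_of_real ?_
  · unfold NewtonPuiseux.PuiseuxData.FactorsComplex
    filter_upwards [hz] with z hz
    exact sub_eq_zero.1 hz
  · have ht : Tendsto (fun z : ℝ × ℝ => (z.1 ^ D.n, z.2)) (𝓝 0) (𝓝 0) :=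
      Continuous.tendsto' (by fun_prop) _ _ (by simp [D.n_pos.ne'])
    filter_upwards [hD, ht.eventually (Metric.ball_mem_nhds 0 hr)] with z hz hzr
    rw [dist_zero_right, Prod.norm_def, max_lt_iff] at hzr
    have h1 := hFf (z.1 ^ D.n) z.2 hzr.1 hzr.2
    simp only [Pi.sub_apply]
    rw [← hz, ← h1]
    simp

theorem NewtonPuiseux.PuiseuxData.FactorsComplex.factorsReal {D : NewtonPuiseux.PuiseuxData}
    {f : ℝ × ℝ → ℝ} {F : ℂ × ℂ → ℂ} (hD : D.FactorsComplex F) {r : ℝ}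
    (hr : 0 < r) (hFf : ∀ x y : ℝ, |x| < r → |y| < r → F (x, y) = f (x, y)) :
    D.FactorsReal f := by
  have ht : Tendsto (fun z : ℝ × ℝ => (z.1 ^ D.n, z.2)) (𝓝 0) (𝓝 0) :=
    Continuous.tendsto' (by fun_prop) _ _ (by simp [D.n_pos.ne'])
  have hc : Tendsto (fun z : ℝ × ℝ => ((z.1 : ℂ), (z.2 : ℂ))) (𝓝 0) (𝓝 0) :=
    Continuous.tendsto' (by fun_prop) _ _ (by simp)
  unfold NewtonPuiseux.PuiseuxData.FactorsReal
  filter_upwards [hc.eventually hD, ht.eventually (Metric.ball_mem_nhds 0 hr)] with z hz hzr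
  rw [dist_zero_right, Prod.norm_def, max_lt_iff] at hzr
  rw [← hz, ← hFf (z.1 ^ D.n) z.2 hzr.1 hzr.2]
  simp

end

theorem proposition3p4 :
    (∀ f : ℂ × ℂ → ℂ, AnalyticAt ℂ f 0 → f 0 = 0 → (¬ ∀ᶠ z in 𝓝 (0 : ℂ × ℂ), f z = 0) →
      (∃ D : NewtonPuiseux.PuiseuxData, D.FactorsComplex f) ∧
      ∀ D : NewtonPuiseux.PuiseuxData, D.FactorsComplex f →
        (∀ (a : ℚ) (b : ℂ), (D.mult a b : ℝ) ≤ (NewtonPuiseux.newtonDist f)⁻¹) →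
        NewtonPuiseux.criticalIndex f = ENNReal.ofReal (2 * NewtonPuiseux.newtonDist f)) ∧
    (∀ f : ℝ × ℝ → ℝ, AnalyticAt ℝ f 0 → f 0 = 0 → (¬ ∀ᶠ z in 𝓝 (0 : ℝ × ℝ), f z = 0) →
      (∃ D : NewtonPuiseux.PuiseuxData, D.FactorsReal f) ∧
      ∀ D : NewtonPuiseux.PuiseuxData, D.FactorsReal f →
        (∀ (a : ℚ) (b : ℂ), (D.mult a b : ℝ) ≤ (NewtonPuiseux.newtonDist f)⁻¹) →
        NewtonPuiseux.criticalIndex f = ENNReal.ofReal (NewtonPuiseux.newtonDist f)) := by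
  refine ⟨fun f hf hf0 hne => ⟨exists_factorsComplex hf hne, fun D hD hm => ?_⟩,
    fun f hf hf0 hne => ?_⟩
  · obtain ⟨a, r, hser⟩ := hf.exists_hasDoubleSeries
    have h := NewtonPuiseux.criticalIndex_eq hser hf0 hne hser (fun _ => Iff.rfl) (e := id)
      (π := id) (fun _ => rfl) (fun _ _ => le_rfl) (fun _ _ _ _ => rfl) hD hm
    rw [h]
    congr 2
    exact_mod_cast Complex.finrank_real_complex
  · obtain ⟨a, r, hser⟩ := hf.exists_hasDoubleSeries
    obtain ⟨F, hF, hFf⟩ := hser.exists_complexification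
    refine ⟨?_, fun D hD hm => ?_⟩
    · have hneF : ¬ ∀ᶠ z in 𝓝 (0 : ℂ × ℂ), F z = 0 := fun hz => by
        have hc : Tendsto (fun z : ℝ × ℝ => ((z.1 : ℂ), (z.2 : ℂ))) (𝓝 0) (𝓝 0) :=
          Continuous.tendsto' (by fun_prop) _ _ (by simp)
        refine hne ?_
        filter_upwards [hc.eventually hz, Metric.ball_mem_nhds 0 hser.r_pos] with z hz hzr
        rw [mem_ball_zero_iff, Prod.norm_def, max_lt_iff] at hzr
        have h1 := hFf z.1 z.2 hzr.1 hzr.2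
        rw [hz] at h1
        exact_mod_cast h1.symm
      obtain ⟨D, hD⟩ := exists_factorsComplex hF.analyticAt hneF
      exact ⟨D, hD.factorsReal hser.r_pos hFf⟩
    -- For real `y`, replacing a complex root by its real part does not increase its distance to
    -- `y`, so the lower bound persists with real singular points.
    · have h := NewtonPuiseux.criticalIndex_eq hser hf0 hne hF (fun _ => Complex.ofReal_ne_zero)
        (e := Complex.ofReal) (π := Complex.re) (fun _ => Complex.norm_real _)
        (fun y w => by simpa using Complex.abs_re_le_norm (y - w))
        (fun x y hx hy => by rw [hFf x y hx hy, Complex.norm_real])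
        (hD.factorsComplex hF.analyticAt hser.r_pos hFf) hm
      rw [h]
      congr 1
      simp
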